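/- **Conventions.** A simplicial complex $X$ over a finite set is a family of subsets closed under taking subsets; $X(i)$ is the set of faces with $i+1$ elements ($i\ge -1$, so $X(-1)=\{\emptyset\}$ if $X\neq\emptyset$), the dimension $n$ of $X$ is the largest $i$ with $X(i)\ne\emptyset$, and $X$ is pure if every face lies in a face of dimension $n$. A weighted simplicial complex $(X,w)$ of dimension $n$ is a pure one with a weight function $w\colon X\to\mathbb{R}_{\ge 0}$ that is balanced: $\sum_{\sigma\in X(n)}w(\sigma)=1$ and $w(\sigma)=\frac{1}{i+2}\sum_{\tau\in X(i+1),\,\tau\supset\sigma}w(\tau)$ for all $i<n$ and $\sigma\in X(i)$. The link of $S\in X$ is $X_S=\{T\setminus S: S\subseteq T\in X\}$, with the weights $w_S(T)\propto w(S\cup T)$ normalized so as to be balanced, i.e. $w_S(T)=w(S\cup T)/\big(\binom{|S|+|T|}{|S|}w(S)\big)$. The normalized adjacency matrix of the weighted $1$-skeleton of $(X,w)$ has the entry $w(\{u,v\})/\sum_{v':\{u,v'\}\in X(1)}w(\{u,v'\})$ at $(u,v)$ if $\{u,v\}\in X(1)$, and $0$ otherwise; if its eigenvalues are $\lambda_1\ge\lambda_2\ge\cdots$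 (real, with multiplicities), the $1$-skeleton is a $\lambda$-onesided-spectral expander when $\lambda_2\le\lambda$. A weighted simplicial complex $(X,w)$ of dimension $n\ge1$ is a $\lambda$-onesided spectral HDX if for every $-1\le i\le n-2$ and every $S\in X(i)$ the weighted $1$-skeleton of $(X_S,w_S)$ is a $\lambda$-onesided-spectral expander. For a group $G$ with subgroups $K_1,\dots,K_d$, the coset complex $\mathcal{X}(G,\{K_1,\dots,K_d\})$ has as vertices the left cosets $gK_i$ (labelled with their type $i$) and as faces the sets of cosets of pairwise distinct types that have a common element. Its weight function is the one induced by the uniform distribution on its faces of dimension $d-1$: the weight of $\sigma\in\mathcal{X}(i)$ is the probability that a uniformly random $(i+1)$-element subset of a uniformly random face of dimension $d-1$ equals $\sigma$. **Theorem (Kaufman–Oppenheim).** Let $p$ be a prime power, let $d\ge3$ and $s\ge1$ be integers with $p>(d-2)^2$, and let $R=\mathbb{F}_p[t]/\langle t^s\rangle$, where $\mathbb{F}_p$ is the field with $p$ elements. For $j\in\{1,\dots,d\}$ and $r\in R$ let $e_{j,j+1}(r)$ be the $d\times d$ matrix over $R$ with $1$'s on the diagonal, $r$ in the entry $(j,j+1)$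 (indices taken cyclically mod $d$, so $e_{d,d+1}=e_{d,1}$) and $0$ elsewhere. For $i\in\{1,\dots,d\}$ let $$K_i=\big\langle e_{j,j+1}(at+b) : a,b\in\mathbb{F}_p,\ j\in\{1,\dots,d\}\setminus\{i\}\big\rangle,\qquad G=\langle K_1,\dots,K_d\rangle .$$ Then the coset complex $\mathcal{X}(G,\{K_1,\dots,K_d\})$, with its weight function, is a weighted simplicial complex of dimension $d-1$ and a $\frac{1}{\sqrt{p}-(d-2)}$-onesided spectral HDX. -/

import Mathlib

/-! ### Weighted simplicial complexes -/

/-- A simplicial complex over `U`: a collection of finite subsets of `U` closed under passing to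
subsets. The empty set is allowed as a face (it is the only face of dimension `-1`), and elements
of `U` need not be vertices. A face of dimension `i` is a face with `i + 1` elements. -/
structure FaceComplex (U : Type*) where
  faces : Set (Finset U)
  down_closed : ∀ S ∈ faces, ∀ T : Finset U, T ⊆ S → T ∈ faces

namespace FaceComplex

variable {U : Type*}

/-- The type of vertices of `X`. -/
def Vertex (X : FaceComplex U) : Type _ := {v : U // {v} ∈ X.faces}

instance [Finite U] (X : FaceComplex U) : Finite X.Vertex := Subtype.finite

noncomputable instance [Finite U] (X : FaceComplex U) : Fintype X.Vertex := Fintype.ofFinite _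

/-- The faces of `X` with exactly `k` elements, i.e. the faces of dimension `k - 1`. -/
noncomputable def facesOfCard [Finite U] (X : FaceComplex U) (k : ℕ) : Finset (Finset U) :=
  (Set.toFinite {S : Finset U | S ∈ X.faces ∧ S.card = k}).toFinset

/-- `X` has dimension `n`: this is the largest dimension of a face. -/
def HasDim (X : FaceComplex U) (n : ℕ) : Prop :=
  (∃ S ∈ X.faces, S.card = n + 1) ∧ ∀ S ∈ X.faces, S.card ≤ n + 1

/-- `X`, of dimension `n`, is pure: every face is contained in a face of dimension `n`. -/
def IsPure (X : FaceComplex U) (n : ℕ) : Prop :=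
  ∀ S ∈ X.faces, ∃ T ∈ X.faces, S ⊆ T ∧ T.card = n + 1

open Classical in
/-- The link of `S` in `X`: all `T \ S` where `T` is a face of `X` that contains `S`. -/
def link (X : FaceComplex U) (S : Finset U) : FaceComplex U where
  faces := {T' | ∃ T ∈ X.faces, S ⊆ T ∧ T' = T \ S}
  down_closed := by
    rintro _ ⟨T, hT, hST, rfl⟩ T'' hT''
    refine ⟨S ∪ T'', X.down_closed T hT _ ?_, Finset.subset_union_left, ?_⟩
    · exact Finset.union_subset hST (hT''.trans Finset.sdiff_subset)
    · ext x
      have := @hT'' x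
      simp only [Finset.mem_sdiff, Finset.mem_union] at this ⊢
      tauto

open Classical in
/-- The weight function `w` on the faces of the `n`-dimensional complex `X` is balanced: the
weights of the top faces sum to `1`, and
`w σ = 1 / (i + 2) * ∑ w τ`, over the faces `τ ⊇ σ` of dimension `i + 1`, for every face `σ` of
dimension `i < n` (so with `k = i + 1` elements, `k ≤ n`). -/
def IsBalanced [Finite U] (X : FaceComplex U) (n : ℕ) (w : Finset U → ℝ) : Prop :=
  (∀ σ ∈ X.faces, 0 ≤ w σ) ∧
  ∑ σ ∈ X.facesOfCard (n + 1), w σ = 1 ∧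
  ∀ k ≤ n, ∀ σ ∈ X.facesOfCard k,
    w σ = 1 / ((k : ℝ) + 1) * ∑ τ ∈ (X.facesOfCard (k + 1)).filter (fun τ => σ ⊆ τ), w τ

/-- `(X, w)` is a weighted (pure) simplicial complex of dimension `n`. -/
def IsWeighted [Finite U] (X : FaceComplex U) (n : ℕ) (w : Finset U → ℝ) : Prop :=
  X.HasDim n ∧ X.IsPure n ∧ X.IsBalanced n w

open Classical in
/-- The weight function induced by the uniform distribution on the `n`-dimensional (top) faces:
`w σ` is the probability of obtaining `σ` by choosing a uniformly random face of dimension `n` and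
then a uniformly random subset of it of the size of `σ`. -/
noncomputable def uniformWeight [Finite U] (X : FaceComplex U) (n : ℕ) (σ : Finset U) : ℝ :=
  (((X.facesOfCard (n + 1)).filter (fun τ => σ ⊆ τ)).card : ℝ) /
    (((X.facesOfCard (n + 1)).card : ℝ) * ((n + 1).choose σ.card : ℝ))

open Classical in
/-- The weight function on the link of `S`: the restriction of `w` to the faces `S ∪ T`, normalized
so that it is again balanced. -/
noncomputable def linkWeight (w : Finset U → ℝ) (S T : Finset U) : ℝ :=
  w (S ∪ T) / (((S.card + T.card).choose S.card : ℝ) * w S)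

open Classical in
/-- The edge weights of the weighted `1`-skeleton of `(X, w)`. -/
noncomputable def edgeWeight (X : FaceComplex U) (w : Finset U → ℝ) (u v : X.Vertex) : ℝ :=
  if u ≠ v ∧ ({u.1, v.1} : Finset U) ∈ X.faces then w {u.1, v.1} else 0

/-- The normalized adjacency matrix of the weighted `1`-skeleton: each edge weight is divided by the
total weight of the edges at the vertex (so that every row sums to `1`). -/
noncomputable def adjMatrix [Finite U] (X : FaceComplex U) (w : Finset U → ℝ) :
    Matrix X.Vertex X.Vertex ℝ :=
  Matrix.of fun u v => X.edgeWeight w u v / ∑ v', X.edgeWeight w u v'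

open Classical in
/-- The weighted `1`-skeleton of `(X, w)` is a `lam`-onesided-spectral expander: in the list
`μ 0 ≥ μ 1 ≥ ...` of the eigenvalues of the normalized adjacency matrix with multiplicities, the
second one is at most `lam`. -/
def IsOnesidedSpectralExpander [Finite U] (X : FaceComplex U) (w : Finset U → ℝ) (lam : ℝ) :
    Prop :=
  ∃ μ : Fin (Fintype.card X.Vertex) → ℝ, Antitone μ ∧
    (X.adjMatrix w).charpoly = ∏ i, (Polynomial.X - Polynomial.C (μ i)) ∧
    ∃ h : 1 < Fintype.card X.Vertex, μ ⟨1, h⟩ ≤ lam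

/-- `(X, w)` is an `n`-dimensional `lam`-onesided spectral HDX: it is a weighted simplicial complex
of dimension `n ≥ 1` and the weighted `1`-skeleton of the link of every face of dimension at most
`n - 2` (including the empty face) is a `lam`-onesided-spectral expander. -/
def IsOnesidedSpectralHDX [Finite U] (X : FaceComplex U) (w : Finset U → ℝ) (n : ℕ) (lam : ℝ) :
    Prop :=
  1 ≤ n ∧ X.IsWeighted n w ∧
    ∀ S ∈ X.faces, S.card + 1 ≤ n →
      (X.link S).IsOnesidedSpectralExpander (linkWeight w S) lam

end FaceComplex

/-! ### Coset complexes -/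

/-- The coset complex of the subgroups `K i` of `G`. Its vertices are the cosets of the `K i`, each
with its type `i`; a set of cosets is a face if its members have a common element `g`. (Two
different cosets of the same type are disjoint, so the members of a face have distinct types.) -/
def cosetComplex {G ι : Type*} [Group G] (K : ι → Subgroup G) :
    FaceComplex (Σ i : ι, G ⧸ K i) where
  faces := {S | ∃ g : G, ∀ v ∈ S, v.2 = (g : G ⧸ K v.1)}
  down_closed := fun _ ⟨g, hg⟩ _ hT => ⟨g, fun v hv => hg v (hT hv)⟩

/-! ### The groups of Kaufman and Oppenheim -/

/-- The ring `F[t] / ⟨t ^ s⟩`. -/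
abbrev TruncPoly (F : Type*) [Field F] (s : ℕ) : Type _ :=
  Polynomial F ⧸ Ideal.span {(Polynomial.X : Polynomial F) ^ s}

instance TruncPoly.finite (F : Type*) [Field F] [Finite F] (s : ℕ) : Finite (TruncPoly F s) := by
  have : Module.Finite F (AdjoinRoot ((Polynomial.X : Polynomial F) ^ s)) :=
    (Polynomial.monic_X_pow s).finite_adjoinRoot
  exact Module.finite_of_finite (M := AdjoinRoot ((Polynomial.X : Polynomial F) ^ s)) F

/-- The class of the linear polynomial `a t + b` in `F[t] / ⟨t ^ s⟩`. -/
noncomputable def TruncPoly.linear {F : Type*} [Field F] (s : ℕ) (a b : F) : TruncPoly F s :=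
  Ideal.Quotient.mk _ (Polynomial.C a * Polynomial.X + Polynomial.C b)

/-- `K i`, the group generated by the elementary matrices `e_{j, j+1}(a t + b)` with `j ≠ i`, where
`j + 1` is taken cyclically. -/
noncomputable def koSubgroup (F : Type*) [Field F] (d s : ℕ) [NeZero d] (i : Fin d) :
    Subgroup (Matrix.SpecialLinearGroup (Fin d) (TruncPoly F s)) :=
  Subgroup.closure {g | ∃ j : Fin d, j ≠ i ∧ ∃ a b : F,
    (g : Matrix (Fin d) (Fin d) (TruncPoly F s)) =
      Matrix.transvection j (j + 1) (TruncPoly.linear s a b)}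

/-- `G`, the group generated by all the `K i`. -/
noncomputable def koGroup (F : Type*) [Field F] (d s : ℕ) [NeZero d] :
    Subgroup (Matrix.SpecialLinearGroup (Fin d) (TruncPoly F s)) :=
  ⨆ i, koSubgroup F d s i

/-- The coset complex of `G` and its subgroups `K i`. -/
noncomputable def koComplex (F : Type*) [Field F] (d s : ℕ) [NeZero d] :
    FaceComplex (Σ i : Fin d, koGroup F d s ⧸ (koSubgroup F d s i).subgroupOf (koGroup F d s)) :=
  cosetComplex fun i => (koSubgroup F d s i).subgroupOf (koGroup F d s)

/-!
The coset complex is shown to be an expander by trickling down from the links of codimension two.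

A spectral gap of a weighted graph is used in the variational form `HasSpectralGap`; the link to the
eigenvalues of the normalized adjacency matrix is `HasSpectralGap.exists_antitone_eigenvalues`, by
the spectral theorem for a similar symmetric matrix. If the links of the vertices of a connected
link have the gap `lam`, then the random walk operator `A` of that link satisfies
`⟨f, A f⟩ ≤ lam ‖f‖² + (1 - lam) ‖A f‖²`, and so its nontrivial eigenvalues are at most
`lam / (1 - lam)` (`HasSpectralGap.of_le_sq`, `linkGraph_trickling_down`). Starting from `1 / √p` in
codimension two, at most `d - 2` such steps lead to `1 / (√p - (d - 2))`
(`linkGraph_hasSpectralGap`).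

For a coset complex, what remains are statements about subgroups
(`cosetComplex_isOnesidedSpectralHDX`). The stabilizer of a face of type `τ` is the intersection of
the `K i` with `i ∈ τ`, and it has to be generated by the stabilizers of the larger faces, which
gives connectedness. Here this intersection is the group generated by the elementary matrices
`e_{j, j+1}` with `j ∉ τ` (`koFaceGroup_inf_le`): erasing the entries of a matrix whose cyclic
interval meets `σ` is multiplicative on matrices that are triangular for a linear order cutting the
cycle, fixes the `e_{j, j+1}` with `j ∉ σ`, and sends the others to `1`.

In codimension two the stabilizer is generated by two families `x`, `y` of elementary matrices whose
commutators `z a b` are central, bilinear, and depend only on the product of the two linear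
polynomials. Let `f` be invariant under `x`. The correlation of `f` with its translate by `y b` is
at most the correlation of `f` with its average over all `z a b`, `a ∈ F × F`
(`IsHeisenberg.card_mul_sum_translate_le`). On functions with vanishing average over all
commutators, the averages for linearly independent `b` and `b'` annihilate each other, which makes
the operator that sums them over all `b` a root of an explicit quadratic polynomial and thus bounds
it (`IsHeisenberg.sum_translateSum_sq`). The resulting gap is `1 / √p`
(`IsHeisenberg.card_mul_sq_sum_mul_le`). The parametrization by `F × F` is not required to be
injective, so that small exponents `s` need no separate treatment.
-/

/-! ### Weighted graphs: spectral gap and trickling down -/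

open Matrix in
/-- Coordinates of the spectral theorem for a real symmetric matrix: the eigenvectors are
orthonormal, and Parseval's identity holds for them. -/
theorem Matrix.IsHermitian.exists_eigenvectors {V : Type*} [Fintype V] [DecidableEq V]
    {M : Matrix V V ℝ} (hM : M.IsHermitian) :
    ∃ e : V → V → ℝ,
      (∀ j k, ∑ u, e j u * e k u = if j = k then 1 else 0) ∧
      (∀ j u, ∑ v, M u v * e j v = hM.eigenvalues j * e j u) ∧
      ∀ x y : V → ℝ, ∑ j, (∑ u, e j u * x u) * (∑ u, e j u * y u) = ∑ u, x u * y u := by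
  refine ⟨fun j => (hM.eigenvectorBasis j).ofLp, fun j k => ?_, fun j u => ?_, fun x y => ?_⟩
  · have h := orthonormal_iff_ite.mp hM.eigenvectorBasis.orthonormal j k
    rw [PiLp.inner_apply] at h
    simpa [mul_comm] using h
  · have h := congrFun (hM.mulVec_eigenvectorBasis j) u
    simpa [Matrix.mulVec, dotProduct] using h
  · have h := hM.eigenvectorBasis.sum_inner_mul_inner (WithLp.toLp 2 x) (WithLp.toLp 2 y)
    simp only [PiLp.inner_apply] at h
    simpa [mul_comm] using h

section WeightedGraph

variable {V : Type*} [Fintype V]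

/-- A spectral gap for the weighted graph on `V` with edge weights `c`, in variational form: the
quadratic form of `c` is at most `lam` times the degree-weighted square norm on all functions of
degree-weighted mean zero. -/
def HasSpectralGap (c : V → V → ℝ) (lam : ℝ) : Prop :=
  ∀ f : V → ℝ, ∑ u, (∑ v, c u v) * f u = 0 →
    ∑ u, ∑ v, c u v * f u * f v ≤ lam * ∑ u, (∑ v, c u v) * f u ^ 2

theorem HasSpectralGap.mono {c : V → V → ℝ} (h0 : ∀ u v, 0 ≤ c u v) {lam lam' : ℝ}
    (h : HasSpectralGap c lam) (hl : lam ≤ lam') : HasSpectralGap c lam' := fun f hf =>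
  (h f hf).trans <| mul_le_mul_of_nonneg_right hl <|
    Finset.sum_nonneg fun u _ => mul_nonneg (Finset.sum_nonneg fun v _ => h0 u v) (sq_nonneg _)

/-- The variational form of the spectral gap for functions of arbitrary mean. If the total degree
vanishes, then so does the last term, by the convention `x / 0 = 0`, and the inequality still
holds. -/
theorem HasSpectralGap.le_add_sq {c : V → V → ℝ} {lam : ℝ} (h : HasSpectralGap c lam)
    (hs : ∀ u v, c u v = c v u) (h0 : ∀ u v, 0 ≤ c u v) (f : V → ℝ) :
    ∑ u, ∑ v, c u v * f u * f v ≤ lam * ∑ u, (∑ v, c u v) * f u ^ 2 +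
      (1 - lam) * ((∑ u, (∑ v, c u v) * f u) ^ 2 / ∑ u, ∑ v, c u v) := by
  have hD0 : ∀ u, 0 ≤ ∑ v, c u v := fun u => Finset.sum_nonneg fun v _ => h0 u v
  rcases eq_or_ne (∑ u, ∑ v, c u v) 0 with hz | hz
  · have hD : ∀ u, ∑ v, c u v = 0 := fun u =>
      (Finset.sum_eq_zero_iff_of_nonneg fun u _ => hD0 u).mp hz u (Finset.mem_univ u)
    have := h f (by simp [hD])
    simpa [hz] using this
  · set E := ∑ u, ∑ v, c u v with hE
    set L := ∑ u, (∑ v, c u v) * f u with hL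
    set m := L / E with hm
    have hmE : m * E = L := by rw [hm]; field_simp
    have h1 := h (fun u => f u - m) (by
      simp only [mul_sub, Finset.sum_sub_distrib, ← Finset.sum_mul]
      rw [← hL, ← hE, mul_comm, hmE, sub_self])
    have e1 : ∑ u, (∑ v, c u v) * (f u - m) ^ 2 =
        ∑ u, (∑ v, c u v) * f u ^ 2 - 2 * m * L + m ^ 2 * E := by
      rw [hL, hE, Finset.mul_sum, Finset.mul_sum, ← Finset.sum_sub_distrib,
        ← Finset.sum_add_distrib]
      exact Finset.sum_congr rfl fun u _ => by ring
    have e3 : ∑ u, ∑ v, c u v * f v = L := by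
      rw [Finset.sum_comm, hL]
      exact Finset.sum_congr rfl fun u _ => by
        rw [Finset.sum_mul]; exact Finset.sum_congr rfl fun v _ => by rw [hs]
    have e4 : ∑ u, ∑ v, c u v * f u = L := by
      rw [hL]; exact Finset.sum_congr rfl fun u _ => by rw [Finset.sum_mul]
    have e2 : ∑ u, ∑ v, c u v * (f u - m) * (f v - m) =
        ∑ u, ∑ v, c u v * f u * f v - 2 * m * L + m ^ 2 * E := by
      have : ∑ u, ∑ v, c u v * (f u - m) * (f v - m) =
        ∑ u, ∑ v, c u v * f u * f v - m * ∑ u, ∑ v, c u v * f v - m * ∑ u, ∑ v, c u v * f u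
          + m ^ 2 * E := by
        simp only [hE, Finset.mul_sum, ← Finset.sum_sub_distrib, ← Finset.sum_add_distrib]
        exact Finset.sum_congr rfl fun u _ => Finset.sum_congr rfl fun v _ => by ring
      rw [this, e3, e4]; ring
    rw [e1, e2] at h1
    have e5 : L ^ 2 / E = m * L := by rw [hm]; ring
    have e6 : m ^ 2 * E = m * L := by rw [← hmE]; ring
    rw [e5]
    rw [e6] at h1
    linarith

/-- The symmetric matrix similar to the normalized adjacency matrix of a weighted graph: each edge
weight is divided by the geometric mean of the degrees of its ends. -/
noncomputable def symmAdjMatrix (c : V → V → ℝ) : Matrix V V ℝ :=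
  Matrix.of fun u v => c u v / (√(∑ w, c u w) * √(∑ w, c v w))

theorem symmAdjMatrix_isHermitian {c : V → V → ℝ} (hs : ∀ u v, c u v = c v u) :
    (symmAdjMatrix c).IsHermitian := by
  ext u v
  simp only [symmAdjMatrix, Matrix.conjTranspose_apply, Matrix.of_apply, star_trivial]
  rw [hs, mul_comm]

theorem charpoly_normalized_eq [DecidableEq V] {c : V → V → ℝ} (h0 : ∀ u v, 0 ≤ c u v) :
    (Matrix.of fun u v => c u v / ∑ w, c u w : Matrix V V ℝ).charpoly =
      (symmAdjMatrix c).charpoly := by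
  have e1 : (Matrix.of fun u v => c u v / ∑ w, c u w : Matrix V V ℝ) =
      Matrix.diagonal (fun u => (√(∑ w, c u w))⁻¹) *
        (Matrix.diagonal (fun u => (√(∑ w, c u w))⁻¹) * Matrix.of c) := by
    ext u v
    have hD : 0 ≤ ∑ w, c u w := Finset.sum_nonneg fun v _ => h0 u v
    simp only [Matrix.diagonal_mul, Matrix.of_apply]
    rw [← mul_assoc, ← mul_inv, Real.mul_self_sqrt hD, div_eq_inv_mul]
  have e2 : symmAdjMatrix c = (Matrix.diagonal (fun u => (√(∑ w, c u w))⁻¹) * Matrix.of c) *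
      Matrix.diagonal (fun u => (√(∑ w, c u w))⁻¹) := by
    ext u v
    simp only [symmAdjMatrix, Matrix.diagonal_mul, Matrix.mul_diagonal, Matrix.of_apply]
    rw [div_eq_mul_inv, mul_inv]; ring
  rw [e1, e2, Matrix.charpoly_mul_comm]

theorem weight_eq_zero_of_degree_eq_zero {c : V → V → ℝ} (h0 : ∀ u v, 0 ≤ c u v) {u : V}
    (hu : √(∑ w, c u w) = 0) (v : V) : c u v = 0 := by
  have hD : 0 ≤ ∑ w, c u w := Finset.sum_nonneg fun v _ => h0 u v
  rw [Real.sqrt_eq_zero hD] at hu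
  exact (Finset.sum_eq_zero_iff_of_nonneg fun v _ => h0 u v).mp hu v (Finset.mem_univ v)

/-- On functions orthogonal to the square root of the degree, the quadratic form of the symmetrized
adjacency matrix of a graph with a spectral gap is bounded by that gap. -/
theorem HasSpectralGap.symmAdjMatrix_form_le {c : V → V → ℝ} {lam : ℝ} (h : HasSpectralGap c lam)
    (h0 : ∀ u v, 0 ≤ c u v) (hl : 0 ≤ lam) {x : V → ℝ} (hx : ∑ u, √(∑ w, c u w) * x u = 0) :
    ∑ u, x u * ∑ v, symmAdjMatrix c u v * x v ≤ lam * ∑ u, x u ^ 2 := by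
  have hD : ∀ u, 0 ≤ ∑ w, c u w := fun u => Finset.sum_nonneg fun v _ => h0 u v
  have key := h (fun u => x u / √(∑ w, c u w)) (by
    rw [← hx]
    refine Finset.sum_congr rfl fun u _ => ?_
    rcases eq_or_ne (√(∑ w, c u w)) 0 with hu | hu
    · simp [hu]
    · nth_rewrite 1 [← Real.mul_self_sqrt (hD u)]
      field_simp)
  calc ∑ u, x u * ∑ v, symmAdjMatrix c u v * x v
      = ∑ u, ∑ v, c u v * (x u / √(∑ w, c u w)) * (x v / √(∑ w, c v w)) := by
        refine Finset.sum_congr rfl fun u _ => ?_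
        rw [Finset.mul_sum]
        refine Finset.sum_congr rfl fun v _ => ?_
        simp only [symmAdjMatrix, Matrix.of_apply]
        rw [div_eq_mul_inv, div_eq_mul_inv, div_eq_mul_inv, mul_inv]; ring
    _ ≤ _ := key
    _ ≤ lam * ∑ u, x u ^ 2 := by
        refine mul_le_mul_of_nonneg_left (Finset.sum_le_sum fun u _ => ?_) hl
        rcases eq_or_ne (√(∑ w, c u w)) 0 with hu | hu
        · simpa [hu] using sq_nonneg (x u)
        · refine le_of_eq ?_
          nth_rewrite 1 [← Real.mul_self_sqrt (hD u)]
          field_simp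

/-- The variational spectral gap bounds the second eigenvalue: if two eigenvalues exceeded `lam`,
then so would the quadratic form at some nonzero combination of the two eigenvectors that is
orthogonal to the square root of the degree. -/
theorem HasSpectralGap.exists_antitone_eigenvalues [DecidableEq V] {c : V → V → ℝ} {lam : ℝ}
    (h : HasSpectralGap c lam) (hs : ∀ u v, c u v = c v u) (h0 : ∀ u v, 0 ≤ c u v) (hl : 0 ≤ lam)
    (hV : 1 < Fintype.card V) :
    ∃ μ : Fin (Fintype.card V) → ℝ, Antitone μ ∧
      (Matrix.of fun u v => c u v / ∑ w, c u w : Matrix V V ℝ).charpoly =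
        ∏ i, (Polynomial.X - Polynomial.C (μ i)) ∧ μ ⟨1, hV⟩ ≤ lam := by
  have hM := symmAdjMatrix_isHermitian hs
  refine ⟨hM.eigenvalues₀, hM.eigenvalues₀_antitone, ?_, ?_⟩
  · rw [charpoly_normalized_eq h0, hM.charpoly_eq]
    refine Fintype.prod_equiv (Fintype.equivOfCardEq (Fintype.card_fin _)).symm _ _ fun i => ?_
    rfl
  · obtain ⟨e, horth, heig, -⟩ := hM.exists_eigenvectors
    set q : Fin (Fintype.card V) ≃ V := Fintype.equivOfCardEq (Fintype.card_fin _)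
    set i0 : Fin (Fintype.card V) := ⟨0, by omega⟩
    set i1 : Fin (Fintype.card V) := ⟨1, hV⟩
    have hq : ∀ i, hM.eigenvalues (q i) = hM.eigenvalues₀ i := fun i => by
      change hM.eigenvalues₀ (q.symm (q i)) = _
      rw [q.symm_apply_apply]
    have h01 : q i0 ≠ q i1 := fun hh => by simpa [i0, i1] using q.injective hh
    by_contra hlt
    push Not at hlt
    have hlt0 : lam < hM.eigenvalues₀ i0 :=
      hlt.trans_le (hM.eigenvalues₀_antitone (by simp [i0, i1, Fin.le_def]))
    -- no nonzero vector in the span of the two top eigenvectors is orthogonal to the root of the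
    -- degree, since the quadratic form would be too large there
    have form : ∀ a b : ℝ, ∑ u, √(∑ w, c u w) * (a * e (q i0) u + b * e (q i1) u) = 0 →
        a = 0 ∧ b = 0 := by
      intro a b hab
      have h1 := h.symmAdjMatrix_form_le h0 hl hab
      have h2 : ∀ u, ∑ v, symmAdjMatrix c u v * (a * e (q i0) v + b * e (q i1) v) =
          a * (hM.eigenvalues₀ i0 * e (q i0) u) + b * (hM.eigenvalues₀ i1 * e (q i1) u) := by
        intro u
        rw [← hq, ← hq, ← heig, ← heig, Finset.mul_sum, Finset.mul_sum,
          ← Finset.sum_add_distrib]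
        exact Finset.sum_congr rfl fun v _ => by ring
      have h3 : ∀ a' b' : ℝ, ∑ u, (a * e (q i0) u + b * e (q i1) u) *
          (a' * e (q i0) u + b' * e (q i1) u) = a * a' + b * b' := by
        intro a' b'
        have : ∑ u, (a * e (q i0) u + b * e (q i1) u) * (a' * e (q i0) u + b' * e (q i1) u) =
          a * a' * ∑ u, e (q i0) u * e (q i0) u + b * b' * ∑ u, e (q i1) u * e (q i1) u
            + (a * b' + b * a') * ∑ u, e (q i0) u * e (q i1) u := by
          simp only [Finset.mul_sum, ← Finset.sum_add_distrib]
          exact Finset.sum_congr rfl fun u _ => by ring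
        rw [this, horth, horth, horth]
        simp [h01]
      have h4 := h3 (a * hM.eigenvalues₀ i0) (b * hM.eigenvalues₀ i1)
      have h5 := h3 a b
      have e1 : ∑ u, (a * e (q i0) u + b * e (q i1) u) *
          ∑ v, symmAdjMatrix c u v * (a * e (q i0) v + b * e (q i1) v) =
          a * (a * hM.eigenvalues₀ i0) + b * (b * hM.eigenvalues₀ i1) := by
        rw [← h4]
        exact Finset.sum_congr rfl fun u _ => by rw [h2]; ring
      have e2 : ∑ u, (a * e (q i0) u + b * e (q i1) u) ^ 2 = a * a + b * b := by
        rw [← h5]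
        exact Finset.sum_congr rfl fun u _ => by ring
      rw [e1, e2] at h1
      have ha : 0 ≤ a * a * (hM.eigenvalues₀ i0 - lam) :=
        mul_nonneg (mul_self_nonneg a) (by linarith)
      have hb : 0 ≤ b * b * (hM.eigenvalues₀ i1 - lam) :=
        mul_nonneg (mul_self_nonneg b) (by linarith)
      have ha' : a * a * (hM.eigenvalues₀ i0 - lam) = 0 := by linarith
      have hb' : b * b * (hM.eigenvalues₀ i1 - lam) = 0 := by linarith
      constructor
      · exact mul_self_eq_zero.mp ((mul_eq_zero.mp ha').resolve_right (by linarith))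
      · exact mul_self_eq_zero.mp ((mul_eq_zero.mp hb').resolve_right (by linarith))
    have expand : ∀ a b : ℝ, ∑ u, √(∑ w, c u w) * (a * e (q i0) u + b * e (q i1) u) =
        a * (∑ u, √(∑ w, c u w) * e (q i0) u) + b * ∑ u, √(∑ w, c u w) * e (q i1) u := by
      intro a b
      simp only [Finset.mul_sum, ← Finset.sum_add_distrib]
      exact Finset.sum_congr rfl fun u _ => by ring
    have h1 := form (∑ u, √(∑ w, c u w) * e (q i1) u) (-∑ u, √(∑ w, c u w) * e (q i0) u)
      (by rw [expand]; ring)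
    have h2 := form 1 0 (by rw [expand]; linarith [h1.2])
    exact one_ne_zero h2.1

theorem sum_mul_sub_sq {c : V → V → ℝ} (hs : ∀ u v, c u v = c v u) (f : V → ℝ) :
    ∑ u, ∑ v, c u v * (f u - f v) ^ 2 =
      2 * ∑ u, (∑ v, c u v) * f u ^ 2 - 2 * ∑ u, ∑ v, c u v * f u * f v := by
  have e1 : ∑ u, ∑ v, c u v * f v ^ 2 = ∑ u, (∑ v, c u v) * f u ^ 2 := by
    rw [Finset.sum_comm]
    exact Finset.sum_congr rfl fun u _ => by
      rw [Finset.sum_mul]; exact Finset.sum_congr rfl fun v _ => by rw [hs]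
  have e2 : ∑ u, ∑ v, c u v * f u ^ 2 = ∑ u, (∑ v, c u v) * f u ^ 2 :=
    Finset.sum_congr rfl fun u _ => by rw [Finset.sum_mul]
  calc ∑ u, ∑ v, c u v * (f u - f v) ^ 2
      = ∑ u, ∑ v, c u v * f u ^ 2 + ∑ u, ∑ v, c u v * f v ^ 2
          - 2 * ∑ u, ∑ v, c u v * f u * f v := by
        simp only [Finset.mul_sum, ← Finset.sum_sub_distrib, ← Finset.sum_add_distrib]
        exact Finset.sum_congr rfl fun u _ => Finset.sum_congr rfl fun v _ => by ring
    _ = _ := by rw [e1, e2]; ring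

/-- The spectral core of trickling down. If a connected weighted graph with random walk operator `A`
satisfies `⟨f, A f⟩ ≤ lam ‖f‖² + (1 - lam) ‖A f‖²`, then every eigenvalue `μ` of `A` satisfies
`(1 - μ) (lam - (1 - lam) μ) ≥ 0`, so that `μ ≤ lam / (1 - lam)` unless `μ = 1`; by connectivity the
eigenvectors with eigenvalue `1` are constant. -/
theorem HasSpectralGap.of_le_sq {c : V → V → ℝ} {lam : ℝ} (hs : ∀ u v, c u v = c v u)
    (h0 : ∀ u v, 0 ≤ c u v) (hl : 0 ≤ lam) (hl1 : lam < 1)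
    (hconn : ∀ f : V → ℝ, (∀ u v, c u v ≠ 0 → f u = f v) →
      ∃ a, ∀ u, ∑ v, c u v ≠ 0 → f u = a)
    (hQ : ∀ f : V → ℝ, ∑ u, ∑ v, c u v * f u * f v ≤ lam * ∑ u, (∑ v, c u v) * f u ^ 2 +
      (1 - lam) * ∑ u, (∑ v, c u v * f v) ^ 2 / ∑ v, c u v) :
    HasSpectralGap c (lam / (1 - lam)) := by
  classical
  have hD : ∀ u, 0 ≤ ∑ w, c u w := fun u => Finset.sum_nonneg fun v _ => h0 u v
  have hss : ∀ u, √(∑ w, c u w) * √(∑ w, c u w) = ∑ w, c u w := fun u =>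
    Real.mul_self_sqrt (hD u)
  have hM := symmAdjMatrix_isHermitian hs
  obtain ⟨e, horth, heig, hpars⟩ := hM.exists_eigenvectors
  have hl' : 0 ≤ lam / (1 - lam) := div_nonneg hl (by linarith)
  -- every eigenvalue is small, unless its eigenvector is the trivial one
  have key : ∀ k, hM.eigenvalues k ≤ lam / (1 - lam) ∨
      ∃ a : ℝ, ∀ u, e k u = a * √(∑ w, c u w) := by
    intro k
    rcases eq_or_ne (hM.eigenvalues k) 0 with hk | hk
    · left; rw [hk]; exact hl'
    set μ := hM.eigenvalues k with hμ
    set f : V → ℝ := fun u => e k u / √(∑ w, c u w) with hf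
    have hef : ∀ u, e k u = √(∑ w, c u w) * f u := by
      intro u
      rcases eq_or_ne (√(∑ w, c u w)) 0 with hu | hu
      · have h1 := heig k u
        rw [Finset.sum_eq_zero (fun v _ => by simp [symmAdjMatrix, hu])] at h1
        rw [hu, zero_mul]
        exact (mul_eq_zero.mp h1.symm).resolve_left hk
      · simp only [hf]; field_simp
    have hA : ∀ u, ∑ v, c u v * f v = μ * (∑ v, c u v) * f u := by
      intro u
      rcases eq_or_ne (√(∑ w, c u w)) 0 with hu | hu
      · have hz := weight_eq_zero_of_degree_eq_zero h0 hu
        simp [hz]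
      · have h1 := heig k u
        rw [hef u] at h1
        have h2 : ∑ v, symmAdjMatrix c u v * e k v = (∑ v, c u v * f v) / √(∑ w, c u w) := by
          rw [Finset.sum_div]
          refine Finset.sum_congr rfl fun v _ => ?_
          simp only [symmAdjMatrix, Matrix.of_apply, hf]
          rw [div_eq_mul_inv, div_eq_mul_inv, div_eq_mul_inv, mul_inv]; ring
        rw [h2, div_eq_iff hu] at h1
        rw [h1]
        nth_rewrite 3 [← hss u]
        ring
    have hE : ∑ u, (∑ v, c u v) * f u ^ 2 = 1 := by
      have h1 := horth k k
      rw [if_pos rfl] at h1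
      rw [← h1]
      refine Finset.sum_congr rfl fun u _ => ?_
      rw [hef u]
      nth_rewrite 1 [← hss u]
      ring
    have hQf : ∑ u, ∑ v, c u v * f u * f v = μ := by
      have : ∀ u, ∑ v, c u v * f u * f v = μ * ((∑ v, c u v) * f u ^ 2) := fun u => by
        have : ∑ v, c u v * f u * f v = f u * ∑ v, c u v * f v := by
          rw [Finset.mul_sum]; exact Finset.sum_congr rfl fun v _ => by ring
        rw [this, hA u]; ring
      simp only [this]
      rw [← Finset.mul_sum, hE, mul_one]
    have hA2 : ∑ u, (∑ v, c u v * f v) ^ 2 / ∑ v, c u v = μ ^ 2 := by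
      have : ∀ u, (∑ v, c u v * f v) ^ 2 / ∑ v, c u v = μ ^ 2 * ((∑ v, c u v) * f u ^ 2) := by
        intro u
        rw [hA u]
        rcases eq_or_ne (∑ w, c u w) 0 with hu | hu
        · simp [hu]
        · field_simp
      simp only [this]
      rw [← Finset.mul_sum, hE, mul_one]
    have h1 := hQ f
    rw [hQf, hE, hA2] at h1
    have h2 := sum_mul_sub_sq hs f
    rw [hE, hQf] at h2
    have h3 : ∀ u, 0 ≤ ∑ v, c u v * (f u - f v) ^ 2 := fun u =>
      Finset.sum_nonneg fun v _ => mul_nonneg (h0 u v) (sq_nonneg _)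
    have h4 : μ ≤ 1 := by
      have := Finset.sum_nonneg fun u (_ : u ∈ Finset.univ) => h3 u
      linarith
    rcases lt_or_eq_of_le h4 with h5 | h5
    · left
      rw [le_div_iff₀ (by linarith)]
      by_contra h6
      push Not at h6
      nlinarith [mul_pos (sub_pos.mpr h5) (sub_pos.mpr h6)]
    · right
      rw [h5, mul_one, sub_self] at h2
      obtain ⟨a, ha⟩ := hconn f fun u v huv => by
        have h6 := (Finset.sum_eq_zero_iff_of_nonneg fun u _ => h3 u).mp h2 u (Finset.mem_univ u)
        have h7 := (Finset.sum_eq_zero_iff_of_nonneg fun v _ =>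
          mul_nonneg (h0 u v) (sq_nonneg _)).mp h6 v (Finset.mem_univ v)
        have h8 := (mul_eq_zero.mp h7).resolve_left huv
        exact sub_eq_zero.mp (pow_eq_zero_iff two_ne_zero |>.mp h8)
      refine ⟨a, fun u => ?_⟩
      rw [hef u]
      rcases eq_or_ne (∑ w, c u w) 0 with hu | hu
      · simp [hu]
      · rw [ha u hu, mul_comm]
  intro f hf
  have hx : ∀ k, (∑ u, e k u * (√(∑ w, c u w) * f u)) *
      (∑ u, e k u * (∑ v, symmAdjMatrix c u v * (√(∑ w, c v w) * f v))) =
      hM.eigenvalues k * (∑ u, e k u * (√(∑ w, c u w) * f u)) ^ 2 := by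
    intro k
    have : ∑ u, e k u * (∑ v, symmAdjMatrix c u v * (√(∑ w, c v w) * f v)) =
        hM.eigenvalues k * ∑ u, e k u * (√(∑ w, c u w) * f u) := by
      simp only [Finset.mul_sum]
      rw [Finset.sum_comm]
      refine Finset.sum_congr rfl fun v _ => ?_
      rw [← mul_assoc, ← heig k v, Finset.sum_mul]
      refine Finset.sum_congr rfl fun u _ => ?_
      simp only [symmAdjMatrix, Matrix.of_apply]
      rw [hs v u, mul_comm (√(∑ w, c v w))]; ring
    rw [this]; ring
  have hb : ∀ k, hM.eigenvalues k * (∑ u, e k u * (√(∑ w, c u w) * f u)) ^ 2 ≤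
      lam / (1 - lam) * (∑ u, e k u * (√(∑ w, c u w) * f u)) ^ 2 := by
    intro k
    rcases key k with h1 | ⟨a, ha⟩
    · exact mul_le_mul_of_nonneg_right h1 (sq_nonneg _)
    · have : ∑ u, e k u * (√(∑ w, c u w) * f u) = 0 := by
        rw [← mul_zero a, ← hf, Finset.mul_sum]
        refine Finset.sum_congr rfl fun u _ => ?_
        rw [ha u]
        nth_rewrite 3 [← hss u]
        ring
      rw [this]; simp
  have e1 : ∑ u, ∑ v, c u v * f u * f v = ∑ u, (√(∑ w, c u w) * f u) *
      (∑ v, symmAdjMatrix c u v * (√(∑ w, c v w) * f v)) := by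
    refine Finset.sum_congr rfl fun u _ => ?_
    rw [Finset.mul_sum]
    refine Finset.sum_congr rfl fun v _ => ?_
    simp only [symmAdjMatrix, Matrix.of_apply]
    rcases eq_or_ne (√(∑ w, c u w)) 0 with hu | hu
    · simp [weight_eq_zero_of_degree_eq_zero h0 hu v]
    rcases eq_or_ne (√(∑ w, c v w)) 0 with hv | hv
    · simp [hs u v, weight_eq_zero_of_degree_eq_zero h0 hv u]
    field_simp
  have e2 : ∑ u, (∑ v, c u v) * f u ^ 2 =
      ∑ u, (√(∑ w, c u w) * f u) * (√(∑ w, c u w) * f u) := by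
    refine Finset.sum_congr rfl fun u _ => ?_
    nth_rewrite 1 [← hss u]
    ring
  rw [e1, e2,
    ← hpars (fun u => √(∑ w, c u w) * f u)
      (fun u => ∑ v, symmAdjMatrix c u v * (√(∑ w, c v w) * f v)),
    ← hpars (fun u => √(∑ w, c u w) * f u) (fun u => √(∑ w, c u w) * f u), Finset.mul_sum]
  refine Finset.sum_le_sum fun k _ => ?_
  rw [hx k, ← sq]
  exact hb k

end WeightedGraph

/-! ### Links in a family of finite sets of constant size -/

/-- A spectral gap restricts along an injection onto a set of vertices that carries all the edges,
and it is not affected by scaling the edge weights. -/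
theorem HasSpectralGap.comap {U V : Type*} [Fintype U] [Fintype V] {c : U → U → ℝ} {lam : ℝ}
    (h : HasSpectralGap c lam) (hs : ∀ u v, c u v = c v u) {e : V → U}
    (he : Function.Injective e) (hc : ∀ u, u ∉ Set.range e → ∀ v, c u v = 0) {κ : ℝ} (hκ : 0 ≤ κ) :
    HasSpectralGap (fun u v => κ * c (e u) (e v)) lam := by
  rcases hκ.eq_or_lt with rfl | hκ
  · intro f _
    simp
  intro f hf
  set F : U → ℝ := Function.extend e f 0
  have hF : ∀ v, F (e v) = f v := fun v => he.extend_apply f 0 v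
  have hsum : ∀ g : U → ℝ, (∀ u, u ∉ Set.range e → g u = 0) → ∑ v, g (e v) = ∑ u, g u :=
    fun g hg => Fintype.sum_of_injective e he _ _ hg fun _ => rfl
  have hdeg : ∀ u, ∑ v, c u (e v) = ∑ v, c u v := fun u =>
    hsum (c u) fun v hv => by rw [hs]; exact hc v hv u
  have e0 : ∑ u, (∑ v, κ * c (e u) (e v)) * f u = κ * ∑ u, (∑ v, c u v) * F u := by
    rw [← hsum fun u => (∑ v, c u v) * F u, Finset.mul_sum]
    · refine Finset.sum_congr rfl fun u _ => ?_
      rw [← Finset.mul_sum, hdeg, hF, mul_assoc]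
    · intro u hu
      simp [hc u hu]
  have e1 : ∑ u, (∑ v, κ * c (e u) (e v)) * f u ^ 2 = κ * ∑ u, (∑ v, c u v) * F u ^ 2 := by
    rw [← hsum fun u => (∑ v, c u v) * F u ^ 2, Finset.mul_sum]
    · refine Finset.sum_congr rfl fun u _ => ?_
      rw [← Finset.mul_sum, hdeg, hF, mul_assoc]
    · intro u hu
      simp [hc u hu]
  have e2 : ∑ u, ∑ v, κ * c (e u) (e v) * f u * f v = κ * ∑ u, ∑ v, c u v * F u * F v := by
    rw [← hsum fun u => ∑ v, c u v * F u * F v, Finset.mul_sum]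
    · refine Finset.sum_congr rfl fun u _ => ?_
      rw [← hsum fun v => c (e u) v * F (e u) * F v, Finset.mul_sum]
      · refine Finset.sum_congr rfl fun v _ => ?_
        rw [hF, hF]; ring
      · intro v hv
        simp [hs (e u) v, hc v hv]
    · intro u hu
      simp [hc u hu]
  rw [e0] at hf
  rw [e1, e2, mul_left_comm]
  exact mul_le_mul_of_nonneg_left (h F ((mul_eq_zero.mp hf).resolve_left hκ.ne')) hκ.le

section LinkGraph

variable {U : Type*}

open Classical in
/-- The number of members of `𝓕` that contain `S`. -/
noncomputable def cofaceCount (𝓕 : Finset (Finset U)) (S : Finset U) : ℝ :=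
  ((𝓕.filter (fun T => S ⊆ T)).card : ℝ)

open Classical in
/-- The weighted graph underlying the link of `S` in the complex generated by `𝓕`: the weight of an
edge `{u, v}` is the number of members of `𝓕` that contain `S ∪ {u, v}`. It is a graph on all of
`U`; the vertices outside of the link are isolated. -/
noncomputable def linkGraph (𝓕 : Finset (Finset U)) (S : Finset U) (u v : U) : ℝ :=
  if u ≠ v ∧ u ∉ S ∧ v ∉ S then cofaceCount 𝓕 (insert u (insert v S)) else 0

theorem cofaceCount_nonneg (𝓕 : Finset (Finset U)) (S : Finset U) : 0 ≤ cofaceCount 𝓕 S :=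
  Nat.cast_nonneg _

theorem cofaceCount_ne_zero_iff {𝓕 : Finset (Finset U)} {S : Finset U} :
    cofaceCount 𝓕 S ≠ 0 ↔ ∃ T ∈ 𝓕, S ⊆ T := by
  classical
  simp only [cofaceCount, ne_eq, Nat.cast_eq_zero, Finset.card_eq_zero, Finset.filter_eq_empty_iff]
  push Not
  rfl

theorem linkGraph_symm (𝓕 : Finset (Finset U)) (S : Finset U) (u v : U) :
    linkGraph 𝓕 S u v = linkGraph 𝓕 S v u := by
  classical
  unfold linkGraph
  by_cases h : u ≠ v ∧ u ∉ S ∧ v ∉ S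
  · rw [if_pos h, if_pos ⟨h.1.symm, h.2.2, h.2.1⟩, Finset.insert_comm]
  · rw [if_neg h, if_neg fun h' => h ⟨h'.1.symm, h'.2.2, h'.2.1⟩]

theorem linkGraph_nonneg (𝓕 : Finset (Finset U)) (S : Finset U) (u v : U) :
    0 ≤ linkGraph 𝓕 S u v := by
  unfold linkGraph
  split_ifs
  exacts [cofaceCount_nonneg _ _, le_rfl]

theorem linkGraph_ne_zero_iff {𝓕 : Finset (Finset U)} {S : Finset U} {u v : U} :
    linkGraph 𝓕 S u v ≠ 0 ↔ u ≠ v ∧ u ∉ S ∧ v ∉ S ∧ ∃ T ∈ 𝓕, S ⊆ T ∧ u ∈ T ∧ v ∈ T := by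
  classical
  unfold linkGraph
  by_cases h : u ≠ v ∧ u ∉ S ∧ v ∉ S
  · rw [if_pos h, cofaceCount_ne_zero_iff]
    simp only [Finset.insert_subset_iff]
    constructor
    · rintro ⟨T, hT, h1, h2, h3⟩
      exact ⟨h.1, h.2.1, h.2.2, T, hT, h3, h1, h2⟩
    · rintro ⟨-, -, -, T, hT, h3, h1, h2⟩
      exact ⟨T, hT, h1, h2, h3⟩
  · rw [if_neg h]
    simp only [ne_eq, not_true_eq_false, false_iff]
    exact fun h' => h ⟨h'.1, h'.2.1, h'.2.2.1⟩

variable [Fintype U] {𝓕 : Finset (Finset U)} {N : ℕ}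

open Classical in
theorem sum_cofaceCount_insert (h𝓕 : ∀ T ∈ 𝓕, T.card = N) (S : Finset U) :
    ∑ v, (if v ∉ S then cofaceCount 𝓕 (insert v S) else 0) =
      ((N : ℝ) - S.card) * cofaceCount 𝓕 S := by
  have h1 : ∀ S', cofaceCount 𝓕 S' = ∑ T ∈ 𝓕, if S' ⊆ T then (1 : ℝ) else 0 := fun S' => by
    rw [cofaceCount, Finset.sum_boole]
  have h2 : ∀ v, (if v ∉ S then cofaceCount 𝓕 (insert v S) else 0) =
      ∑ T ∈ 𝓕, if v ∉ S ∧ insert v S ⊆ T then (1 : ℝ) else 0 := by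
    intro v
    by_cases hv : v ∈ S <;> simp [hv, h1]
  simp only [h2]
  rw [Finset.sum_comm, h1, Finset.mul_sum]
  refine Finset.sum_congr rfl fun T hT => ?_
  by_cases hST : S ⊆ T
  · rw [if_pos hST, mul_one, Finset.sum_boole]
    have : (Finset.univ.filter fun v => v ∉ S ∧ insert v S ⊆ T) = T \ S := by
      ext v
      simp only [Finset.mem_filter, Finset.mem_univ, true_and, Finset.insert_subset_iff,
        Finset.mem_sdiff]
      tauto
    rw [this, Finset.card_sdiff_of_subset hST, h𝓕 T hT,
      Nat.cast_sub (h𝓕 T hT ▸ Finset.card_le_card hST)]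
  · rw [if_neg hST, mul_zero]
    refine Finset.sum_eq_zero fun v _ => if_neg fun h => hST ?_
    exact (Finset.subset_insert v S).trans h.2

open Classical in
theorem sum_linkGraph (h𝓕 : ∀ T ∈ 𝓕, T.card = N) (S : Finset U) (u : U) :
    ∑ v, linkGraph 𝓕 S u v =
      if u ∉ S then ((N : ℝ) - S.card - 1) * cofaceCount 𝓕 (insert u S) else 0 := by
  by_cases hu : u ∈ S
  · simp [hu, linkGraph]
  · rw [if_pos hu]
    have h1 := sum_cofaceCount_insert h𝓕 (insert u S)
    rw [Finset.card_insert_of_notMem hu] at h1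
    push_cast at h1
    rw [sub_sub, ← h1]
    refine Finset.sum_congr rfl fun v _ => ?_
    unfold linkGraph
    refine if_congr ?_ (by rw [Finset.insert_comm]) rfl
    simp only [Finset.mem_insert, not_or, hu, not_false_eq_true, true_and, ne_eq, eq_comm]

open Classical in
theorem sum_linkGraph_insert (h𝓕 : ∀ T ∈ 𝓕, T.card = N) {S : Finset U} {w : U} (hw : w ∉ S)
    (u : U) :
    ∑ v, linkGraph 𝓕 (insert w S) u v = ((N : ℝ) - S.card - 2) * linkGraph 𝓕 S w u := by
  have h1 := sum_linkGraph h𝓕 (insert w S) u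
  rw [Finset.card_insert_of_notMem hw] at h1
  have e : ((N : ℝ) - ((S.card + 1 : ℕ) : ℝ) - 1) = (N : ℝ) - S.card - 2 := by push_cast; ring
  rw [h1, e]
  unfold linkGraph
  by_cases hu : u ∈ insert w S
  · have : ¬ (w ≠ u ∧ w ∉ S ∧ u ∉ S) := by
      rintro ⟨h1, h2, h3⟩
      rcases Finset.mem_insert.mp hu with h4 | h4
      exacts [h1 h4.symm, h3 h4]
    rw [if_neg (not_not.mpr hu), if_neg this, mul_zero]
  · have hu' := hu
    rw [Finset.mem_insert, not_or] at hu'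
    rw [if_pos hu, if_pos ⟨fun h => hu'.1 h.symm, hw, hu'.2⟩, Finset.insert_comm]

open Classical in
theorem sum_linkGraph_insert_apply (h𝓕 : ∀ T ∈ 𝓕, T.card = N) (S : Finset U) (u v : U) :
    ∑ w, (if w ∉ S then linkGraph 𝓕 (insert w S) u v else 0) =
      ((N : ℝ) - S.card - 2) * linkGraph 𝓕 S u v := by
  by_cases h : u ≠ v ∧ u ∉ S ∧ v ∉ S
  · have h1 := sum_cofaceCount_insert h𝓕 (insert u (insert v S))
    rw [Finset.card_insert_of_notMem (by simp [h.1, h.2.1]),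
      Finset.card_insert_of_notMem h.2.2] at h1
    have e : ((N : ℝ) - ((S.card + 1 + 1 : ℕ) : ℝ)) = (N : ℝ) - S.card - 2 := by push_cast; ring
    rw [e] at h1
    have h2 : linkGraph 𝓕 S u v = cofaceCount 𝓕 (insert u (insert v S)) := if_pos h
    rw [h2, ← h1]
    refine Finset.sum_congr rfl fun w _ => ?_
    by_cases hw : w ∈ insert u (insert v S)
    · rw [if_neg (not_not.mpr hw)]
      by_cases hwS : w ∈ S
      · exact if_neg (not_not.mpr hwS)
      · rw [if_pos hwS]
        refine if_neg fun h' => ?_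
        simp only [Finset.mem_insert] at hw h'
        rcases hw with rfl | rfl | hw
        · exact h'.2.1 (Or.inl rfl)
        · exact h'.2.2 (Or.inl rfl)
        · exact hwS hw
    · have hw' := hw
      simp only [Finset.mem_insert, not_or] at hw'
      rw [if_pos hw'.2.2, if_pos hw, linkGraph, if_pos]
      · rw [Finset.insert_comm w u, Finset.insert_comm w v]
      · simp only [Finset.mem_insert, not_or]
        exact ⟨h.1, ⟨fun h => hw'.1 h.symm, h.2.1⟩, fun h => hw'.2.1 h.symm, h.2.2⟩
  · have h2 : linkGraph 𝓕 S u v = 0 := if_neg h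
    rw [h2, mul_zero]
    refine Finset.sum_eq_zero fun w _ => ?_
    by_cases hw : w ∈ S
    · exact if_neg (not_not.mpr hw)
    · rw [if_pos hw]
      refine if_neg fun h' => h ?_
      simp only [Finset.mem_insert, not_or] at h'
      exact ⟨h'.1, h'.2.1.2, h'.2.2.2⟩

/-- Connectedness of the graph underlying the link of `S`, isolated vertices being disregarded: a
function that is constant along edges is constant on the vertices of the link. -/
def LinkConnected (𝓕 : Finset (Finset U)) (S : Finset U) : Prop :=
  ∀ f : U → ℝ, (∀ u v, linkGraph 𝓕 S u v ≠ 0 → f u = f v) →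
    ∃ a, ∀ u, ∑ v, linkGraph 𝓕 S u v ≠ 0 → f u = a

open Classical in
/-- Oppenheim's trickling down theorem: a spectral gap of the links of all vertices of a connected
link implies one of the link itself. The quadratic form of a link is the average of the forms of the
links of its vertices, and the mean of `f` on the link of a vertex `w` is the value at `w` of the
random walk operator on `f`. -/
theorem linkGraph_trickling_down (h𝓕 : ∀ T ∈ 𝓕, T.card = N) {S : Finset U}
    (hS : S.card + 3 ≤ N) {lam : ℝ} (hl : 0 ≤ lam) (hl1 : lam < 1)
    (hlink : ∀ w, w ∉ S → HasSpectralGap (linkGraph 𝓕 (insert w S)) lam)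
    (hconn : LinkConnected 𝓕 S) : HasSpectralGap (linkGraph 𝓕 S) (lam / (1 - lam)) := by
  refine HasSpectralGap.of_le_sq (linkGraph_symm 𝓕 S) (linkGraph_nonneg 𝓕 S) hl hl1 hconn
    fun f => ?_
  set κ : ℝ := (N : ℝ) - S.card - 2 with hκ
  have hκ0 : 0 < κ := by
    have : ((S.card + 3 : ℕ) : ℝ) ≤ N := by exact_mod_cast hS
    push_cast at this
    rw [hκ]; linarith
  have hQ : κ * ∑ u, ∑ v, linkGraph 𝓕 S u v * f u * f v =
      ∑ w, if w ∉ S then ∑ u, ∑ v, linkGraph 𝓕 (insert w S) u v * f u * f v else 0 := by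
    calc κ * ∑ u, ∑ v, linkGraph 𝓕 S u v * f u * f v
        = ∑ u, ∑ v, ∑ w, (if w ∉ S then linkGraph 𝓕 (insert w S) u v * f u * f v else 0) := by
          simp only [Finset.mul_sum]
          refine Finset.sum_congr rfl fun u _ => Finset.sum_congr rfl fun v _ => ?_
          have := sum_linkGraph_insert_apply h𝓕 S u v
          rw [← hκ] at this
          rw [← mul_assoc, ← mul_assoc, ← this, Finset.sum_mul, Finset.sum_mul]
          refine Finset.sum_congr rfl fun w _ => ?_
          split_ifs <;> simp
      _ = ∑ u, ∑ w, ∑ v, (if w ∉ S then linkGraph 𝓕 (insert w S) u v * f u * f v else 0) :=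
          Finset.sum_congr rfl fun u _ => Finset.sum_comm
      _ = ∑ w, ∑ u, ∑ v, (if w ∉ S then linkGraph 𝓕 (insert w S) u v * f u * f v else 0) :=
          Finset.sum_comm
      _ = _ := Finset.sum_congr rfl fun w _ => by split_ifs <;> simp
  have hb : ∀ w, (if w ∉ S then ∑ u, ∑ v, linkGraph 𝓕 (insert w S) u v * f u * f v else 0) ≤
      κ * (lam * ∑ u, linkGraph 𝓕 S w u * f u ^ 2 +
        (1 - lam) * ((∑ u, linkGraph 𝓕 S w u * f u) ^ 2 / ∑ u, linkGraph 𝓕 S w u)) := by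
    intro w
    by_cases hw : w ∈ S
    · simp [hw, linkGraph]
    · rw [if_pos hw]
      have h1 := (hlink w hw).le_add_sq (linkGraph_symm _ _) (linkGraph_nonneg _ _) f
      simp only [sum_linkGraph_insert h𝓕 hw, ← hκ, mul_assoc κ, ← Finset.mul_sum] at h1
      refine h1.trans (le_of_eq ?_)
      have h2 : (κ * ∑ u, linkGraph 𝓕 S w u * f u) ^ 2 / (κ * ∑ u, linkGraph 𝓕 S w u) =
          κ * ((∑ u, linkGraph 𝓕 S w u * f u) ^ 2 / ∑ u, linkGraph 𝓕 S w u) := by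
        rw [mul_pow, sq κ, mul_assoc κ κ, mul_div_mul_left _ _ hκ0.ne', mul_div_assoc]
      rw [h2]; ring
  have hsum := Finset.sum_le_sum fun w (_ : w ∈ Finset.univ) => hb w
  rw [← hQ, ← Finset.mul_sum] at hsum
  refine (le_of_mul_le_mul_left hsum hκ0).trans (le_of_eq ?_)
  rw [Finset.sum_add_distrib, ← Finset.mul_sum, ← Finset.mul_sum, Finset.sum_comm]
  congr 2
  refine Finset.sum_congr rfl fun u _ => ?_
  rw [Finset.sum_mul]
  exact Finset.sum_congr rfl fun w _ => by rw [linkGraph_symm]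

/-- Iterated trickling down, from the links of codimension two to all links. -/
theorem linkGraph_hasSpectralGap (h𝓕 : ∀ T ∈ 𝓕, T.card = N) {β : ℝ}
    (hbase : ∀ S : Finset U, S.card + 2 = N → HasSpectralGap (linkGraph 𝓕 S) (1 / β))
    (hconn : ∀ S : Finset U, S.card + 3 ≤ N → LinkConnected 𝓕 S) :
    ∀ m : ℕ, (m : ℝ) < β → ∀ S : Finset U, S.card + (m + 2) = N →
      HasSpectralGap (linkGraph 𝓕 S) (1 / (β - m))
  | 0, _, S, hS => by simpa using hbase S hS
  | m + 1, hm, S, hS => by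
    classical
    push_cast at hm
    have h1 : 1 < β - m := by linarith
    have h2 := linkGraph_trickling_down h𝓕 (S := S) (by omega) (lam := 1 / (β - m))
      (by positivity) (by rw [div_lt_one (by linarith)]; exact h1)
      (fun w hw => linkGraph_hasSpectralGap h𝓕 hbase hconn m (by linarith) _
        (by rw [Finset.card_insert_of_notMem hw]; omega))
      (hconn S (by omega))
    have e : 1 / (β - m) / (1 - 1 / (β - m)) = 1 / (β - ((m + 1 : ℕ) : ℝ)) := by
      have h3 : β - m ≠ 0 := by linarith
      have h4 : β - m - 1 ≠ 0 := by linarith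
      have h5 : β - (m + 1) ≠ 0 := by linarith
      push_cast
      field_simp
      ring
    rwa [e] at h2

end LinkGraph

section LinkGraphSum

variable {U : Type*} [Fintype U]

/-- Sums over the edges of a link, as sums over the members of `𝓕` that contain it. -/
theorem sum_linkGraph_mul [hU : DecidableEq U] (𝓕 : Finset (Finset U)) (S : Finset U)
    (G : U → U → ℝ) :
    ∑ u, ∑ v, linkGraph 𝓕 S u v * G u v =
      ∑ T ∈ 𝓕.filter (fun T => S ⊆ T), ∑ u ∈ T \ S, ∑ v ∈ T \ S, if u ≠ v then G u v else 0 := by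
  obtain rfl : hU = fun u v => Classical.propDecidable (u = v) := Subsingleton.elim _ _
  classical
  have h1 : ∀ u v, linkGraph 𝓕 S u v * G u v = ∑ T ∈ 𝓕.filter (fun T => S ⊆ T),
      if u ∈ T \ S then if v ∈ T \ S then if u ≠ v then G u v else 0 else 0 else 0 := by
    intro u v
    have h2 : linkGraph 𝓕 S u v = ∑ T ∈ 𝓕.filter (fun T => S ⊆ T),
        if u ∈ T \ S ∧ v ∈ T \ S ∧ u ≠ v then 1 else 0 := by
      unfold linkGraph
      rw [Finset.sum_boole, Finset.filter_filter]
      split_ifs with h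
      · unfold cofaceCount
        congr 2
        ext T
        simp only [Finset.mem_filter, Finset.insert_subset_iff, Finset.mem_sdiff]
        tauto
      · symm
        rw [Nat.cast_eq_zero, Finset.card_eq_zero, Finset.filter_eq_empty_iff]
        rintro T - ⟨-, h1, h2, h3⟩
        exact h ⟨h3, (Finset.mem_sdiff.mp h1).2, (Finset.mem_sdiff.mp h2).2⟩
    rw [h2, Finset.sum_mul]
    refine Finset.sum_congr rfl fun T _ => ?_
    by_cases hu : u ∈ T \ S <;> by_cases hv : v ∈ T \ S <;> by_cases huv : u = v <;>
      simp only [hu, hv, huv, if_true, if_false, and_self, and_true, and_false, ne_eq,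
        not_true_eq_false, not_false_eq_true, one_mul, zero_mul]
  simp only [h1]
  rw [Finset.sum_congr rfl fun u _ => Finset.sum_comm, Finset.sum_comm]
  refine Finset.sum_congr rfl fun T _ => ?_
  rw [← Finset.sum_filter_add_sum_filter_not Finset.univ (fun u => u ∈ T \ S)]
  rw [Finset.sum_eq_zero (s := Finset.univ.filter fun u => ¬ u ∈ T \ S), add_zero]
  · rw [Finset.filter_mem_eq_inter, Finset.univ_inter]
    refine Finset.sum_congr rfl fun u hu => ?_
    simp only [hu, if_true]
    rw [← Finset.sum_filter, Finset.filter_mem_eq_inter, Finset.univ_inter]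
  · intro u hu
    simp only [(Finset.mem_filter.mp hu).2, if_false, Finset.sum_const_zero]

theorem hasSpectralGap_of_not_subset {𝓕 : Finset (Finset U)} {S : Finset U}
    (h : ¬ ∃ T ∈ 𝓕, S ⊆ T) (lam : ℝ) : HasSpectralGap (linkGraph 𝓕 S) lam := by
  have : ∀ u v, linkGraph 𝓕 S u v = 0 := fun u v => by
    by_contra hne
    obtain ⟨-, -, -, T, hT, hST, -⟩ := linkGraph_ne_zero_iff.mp hne
    exact h ⟨T, hT, hST⟩
  intro f _
  simp [this]

end LinkGraphSum

/-! ### The uniform weight on a pure complex -/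

namespace FaceComplex

variable {U : Type*} [Finite U] {X : FaceComplex U} {n : ℕ}

theorem mem_facesOfCard {k : ℕ} {S : Finset U} :
    S ∈ X.facesOfCard k ↔ S ∈ X.faces ∧ S.card = k := by
  simp [facesOfCard]

theorem uniformWeight_eq (X : FaceComplex U) (n : ℕ) (σ : Finset U) :
    X.uniformWeight n σ = cofaceCount (X.facesOfCard (n + 1)) σ /
      (((X.facesOfCard (n + 1)).card : ℝ) * ((n + 1).choose σ.card : ℝ)) := rfl

theorem facesOfCard_card_pos (hd : X.HasDim n) : 0 < (X.facesOfCard (n + 1)).card := by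
  obtain ⟨S, hS, hc⟩ := hd.1
  exact Finset.card_pos.mpr ⟨S, mem_facesOfCard.mpr ⟨hS, hc⟩⟩

open Classical in
theorem sum_cofaceCount_facesOfCard {k : ℕ} {σ : Finset U} (hσ : σ.card = k) :
    ∑ τ ∈ (X.facesOfCard (k + 1)).filter (fun τ => σ ⊆ τ),
      cofaceCount (X.facesOfCard (n + 1)) τ =
      ((n : ℝ) + 1 - k) * cofaceCount (X.facesOfCard (n + 1)) σ := by
  cases nonempty_fintype U
  have h := sum_cofaceCount_insert (𝓕 := X.facesOfCard (n + 1)) (N := n + 1)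
    (fun T hT => (mem_facesOfCard.mp hT).2) σ
  rw [hσ] at h
  push_cast at h
  rw [← h, ← Finset.sum_filter]
  symm
  have hsub : ∑ v ∈ Finset.univ.filter (fun v => v ∉ σ ∧ insert v σ ∈ X.faces),
      cofaceCount (X.facesOfCard (n + 1)) (insert v σ) =
      ∑ v ∈ Finset.univ.filter (fun v => v ∉ σ),
        cofaceCount (X.facesOfCard (n + 1)) (insert v σ) := by
    refine Finset.sum_subset (fun v hv => ?_) fun v hv hv' => ?_
    · simp only [Finset.mem_filter, Finset.mem_univ, true_and] at hv ⊢
      exact hv.1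
    · simp only [Finset.mem_filter, Finset.mem_univ, true_and] at hv hv'
      by_contra hne
      obtain ⟨T, hT, hsT⟩ := cofaceCount_ne_zero_iff.mp hne
      exact hv' ⟨hv, X.down_closed T (mem_facesOfCard.mp hT).1 _ hsT⟩
  rw [← hsub]
  refine Finset.sum_of_injOn (fun v => insert v σ) ?_ ?_ ?_ fun _ _ => rfl
  · intro u hu v hv huv
    simp only [Finset.coe_filter, Finset.mem_univ, true_and, Set.mem_ofPred_eq] at hu hv huv
    have : u ∈ insert v σ := huv ▸ Finset.mem_insert_self u σ
    exact (Finset.mem_insert.mp this).resolve_right hu.1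
  · intro v hv
    simp only [Finset.coe_filter, Finset.mem_univ, true_and, Set.mem_ofPred_eq] at hv ⊢
    exact ⟨mem_facesOfCard.mpr ⟨hv.2, by rw [Finset.card_insert_of_notMem hv.1, hσ]⟩,
      Finset.subset_insert v σ⟩
  · intro τ hτ hτ'
    exfalso
    apply hτ'
    simp only [Finset.mem_filter] at hτ
    obtain ⟨hτ1, hτ2⟩ := hτ
    obtain ⟨hτ1, hτ3⟩ := mem_facesOfCard.mp hτ1
    obtain ⟨v, hv, rfl⟩ : ∃ v, v ∉ σ ∧ insert v σ = τ := by
      obtain ⟨v, hv⟩ := Finset.card_eq_one.mp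
        (show (τ \ σ).card = 1 by rw [Finset.card_sdiff_of_subset hτ2]; omega)
      have hv' : v ∈ τ \ σ := hv ▸ Finset.mem_singleton_self v
      refine ⟨v, (Finset.mem_sdiff.mp hv').2, ?_⟩
      rw [Finset.insert_eq, ← hv, Finset.sdiff_union_of_subset hτ2]
    exact ⟨v, by simpa using ⟨hv, hτ1⟩, rfl⟩

/-- The uniform distribution on the top faces induces a balanced weight. -/
theorem isWeighted_uniformWeight (hd : X.HasDim n) (hp : X.IsPure n) :
    X.IsWeighted n (X.uniformWeight n) := by
  classical
  have hM : ((X.facesOfCard (n + 1)).card : ℝ) ≠ 0 := by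
    exact_mod_cast (facesOfCard_card_pos hd).ne'
  refine ⟨hd, hp, fun σ _ => ?_, ?_, fun k hk σ hσ => ?_⟩
  · rw [uniformWeight_eq]
    have := cofaceCount_nonneg (X.facesOfCard (n + 1)) σ
    positivity
  · have h1 : ∀ σ ∈ X.facesOfCard (n + 1), X.uniformWeight n σ =
        1 / ((X.facesOfCard (n + 1)).card : ℝ) := by
      intro σ hσ
      have hc := (mem_facesOfCard.mp hσ).2
      have : cofaceCount (X.facesOfCard (n + 1)) σ = 1 := by
        unfold cofaceCount
        rw [Nat.cast_eq_one, Finset.card_eq_one]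
        refine ⟨σ, ?_⟩
        ext τ
        simp only [Finset.mem_filter, Finset.mem_singleton]
        constructor
        · rintro ⟨hτ, hs⟩
          exact (Finset.eq_of_subset_of_card_le hs
            (by rw [hc, (mem_facesOfCard.mp hτ).2])).symm
        · rintro rfl
          exact ⟨hσ, subset_rfl⟩
      rw [uniformWeight_eq, this, hc]
      simp
    rw [Finset.sum_congr rfl h1, Finset.sum_const, nsmul_eq_mul]
    field_simp
  · have hc := (mem_facesOfCard.mp hσ).2
    have h1 : ∀ τ ∈ (X.facesOfCard (k + 1)).filter (fun τ => σ ⊆ τ), X.uniformWeight n τ =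
        cofaceCount (X.facesOfCard (n + 1)) τ *
          (1 / (((X.facesOfCard (n + 1)).card : ℝ) * ((n + 1).choose (k + 1) : ℝ))) := by
      intro τ hτ
      rw [uniformWeight_eq, (mem_facesOfCard.mp (Finset.mem_filter.mp hτ).1).2]
      ring
    rw [Finset.sum_congr rfl h1, ← Finset.sum_mul, sum_cofaceCount_facesOfCard hc,
      uniformWeight_eq, hc]
    have h2 : ((n + 1).choose (k + 1) : ℝ) * (k + 1) = (n + 1).choose k * (n + 1 - k) := by
      have := Nat.choose_succ_right_eq (n + 1) k
      have h3 : (((n + 1).choose (k + 1) * (k + 1) : ℕ) : ℝ) =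
          ((n + 1).choose k * (n + 1 - k) : ℕ) := by rw [this]
      push_cast [Nat.cast_sub (show k ≤ n + 1 by omega)] at h3
      exact h3
    have h3 : ((n + 1).choose k : ℝ) ≠ 0 := by
      exact_mod_cast (Nat.choose_pos (by omega)).ne'
    have h4 : ((n + 1).choose (k + 1) : ℝ) ≠ 0 := by
      exact_mod_cast (Nat.choose_pos (by omega)).ne'
    have h5 : (k : ℝ) + 1 ≠ 0 := by positivity
    field_simp
    linear_combination (cofaceCount (X.facesOfCard (n + 1)) σ) * h2

/-- The weighted `1`-skeleton of a link is, up to scaling and isolated vertices, the graph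
`linkGraph` of the family of top faces. -/
theorem isOnesidedSpectralExpander_link [Fintype U] (hd : X.HasDim n) (hp : X.IsPure n)
    {S : Finset U} (hS : S ∈ X.faces) (hSn : S.card + 1 ≤ n) {lam : ℝ} (hl : 0 ≤ lam)
    (hgap : HasSpectralGap (linkGraph (X.facesOfCard (n + 1)) S) lam) :
    (X.link S).IsOnesidedSpectralExpander (linkWeight (X.uniformWeight n) S) lam := by
  classical
  set 𝓕 := X.facesOfCard (n + 1) with h𝓕
  have hvert : ∀ u, {u} ∈ (X.link S).faces ↔ u ∉ S ∧ insert u S ∈ X.faces := by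
    intro u
    constructor
    · rintro ⟨T, hT, hST, hu⟩
      have hu' : u ∈ T \ S := hu ▸ Finset.mem_singleton_self u
      rw [Finset.mem_sdiff] at hu'
      exact ⟨hu'.2, X.down_closed T hT _ (Finset.insert_subset hu'.1 hST)⟩
    · rintro ⟨hu, hT⟩
      refine ⟨_, hT, Finset.subset_insert u S, ?_⟩
      rw [Finset.insert_sdiff_of_notMem _ hu, Finset.sdiff_self]
      rfl
  -- the normalizations of `uniformWeight` and `linkWeight` on edges of the link
  set κ : ℝ := 1 / ((𝓕.card : ℝ) * ((n + 1).choose (S.card + 2) : ℝ)) /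
    (((S.card + 2).choose S.card : ℝ) * X.uniformWeight n S) with hκ
  have hκ0 : 0 ≤ κ := by
    have h1 : 0 ≤ X.uniformWeight n S := (isWeighted_uniformWeight hd hp).2.2.1 S hS
    positivity
  have hedge : ∀ u v : (X.link S).Vertex,
      (X.link S).edgeWeight (linkWeight (X.uniformWeight n) S) u v =
        κ * linkGraph 𝓕 S u.1 v.1 := by
    intro u v
    have hu := ((hvert u.1).mp u.2).1
    have hv := ((hvert v.1).mp v.2).1
    by_cases huv : u = v
    · simp [edgeWeight, linkGraph, huv]
    have huv' : u.1 ≠ v.1 := fun h => huv (Subtype.ext h)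
    have hlg : linkGraph 𝓕 S u.1 v.1 = cofaceCount 𝓕 (insert u.1 (insert v.1 S)) :=
      if_pos ⟨huv', hu, hv⟩
    have hun : S ∪ {u.1, v.1} = insert u.1 (insert v.1 S) := by
      ext x; simp only [Finset.mem_union, Finset.mem_insert, Finset.mem_singleton]; tauto
    unfold edgeWeight
    split_ifs with hc
    · have hc2 : ({u.1, v.1} : Finset U).card = 2 := Finset.card_pair huv'
      have hc3 : (insert u.1 (insert v.1 S)).card = S.card + 2 := by
        rw [Finset.card_insert_of_notMem (by simp [huv', hu]), Finset.card_insert_of_notMem hv]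
      rw [linkWeight, hun, hc2, uniformWeight_eq, hc3, hlg, hκ, ← h𝓕]
      ring
    · rw [hlg]
      symm
      convert mul_zero κ
      by_contra hne
      obtain ⟨T, hT, hsT⟩ := cofaceCount_ne_zero_iff.mp hne
      refine hc ⟨huv, insert u.1 (insert v.1 S),
        X.down_closed T (mem_facesOfCard.mp hT).1 _ hsT,
        (Finset.subset_insert _ _).trans (Finset.subset_insert _ _), ?_⟩
      rw [← hun, Finset.union_sdiff_left, eq_comm, Finset.sdiff_eq_self_iff_disjoint]
      simp [hu, hv]
  have hcard : 1 < Fintype.card (X.link S).Vertex := by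
    obtain ⟨T, hT, hST, hTc⟩ := hp S hS
    obtain ⟨a, ha, b, hb, hab⟩ := Finset.one_lt_card.mp
      (show 1 < (T \ S).card by rw [Finset.card_sdiff_of_subset hST]; omega)
    have hmem : ∀ x ∈ T \ S, {x} ∈ (X.link S).faces := fun x hx => by
      rw [Finset.mem_sdiff] at hx
      exact (hvert x).mpr ⟨hx.2, X.down_closed T hT _ (Finset.insert_subset hx.1 hST)⟩
    exact Fintype.one_lt_card_iff.mpr
      ⟨⟨a, hmem a ha⟩, ⟨b, hmem b hb⟩, fun h => hab (congrArg Subtype.val h)⟩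
  have hgap' := hgap.comap (linkGraph_symm 𝓕 S) (e := fun v : (X.link S).Vertex => v.1)
    Subtype.val_injective (fun u hu v => by
      by_contra hne
      obtain ⟨-, h1, -, T, hT, hST, huT, -⟩ := linkGraph_ne_zero_iff.mp hne
      exact hu ⟨⟨u, (hvert u).mpr ⟨h1, X.down_closed T (mem_facesOfCard.mp hT).1 _
        (Finset.insert_subset huT hST)⟩⟩, rfl⟩) hκ0
  obtain ⟨μ, h1, h2, h3⟩ := hgap'.exists_antitone_eigenvalues
    (fun u v => by rw [linkGraph_symm]) (fun u v => mul_nonneg hκ0 (linkGraph_nonneg _ _ _ _))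
    hl hcard
  refine ⟨μ, h1, ?_, hcard, h3⟩
  rw [← h2]
  congr 1
  ext u v
  simp only [adjMatrix, Matrix.of_apply, hedge]

end FaceComplex

/-! ### Averages over translations in a finite group -/

section TranslateSum

variable {H : Type*} [Group H] {A : Type*} [Fintype A]

/-- The sum of the right translates of `f` by the elements `w a`. -/
def translateSum (w : A → H) (f : H → ℝ) (h : H) : ℝ :=
  ∑ a, f (h * w a)

theorem translateSum_of_invariant {w : A → H} {g : H → ℝ} (hg : ∀ h a, g (h * w a) = g h) (h : H) :
    translateSum w g h = Fintype.card A * g h := by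
  simp [translateSum, hg]

theorem translateSum_apply_mul [AddGroup A] {w : A → H} (hw : ∀ a b, w (a + b) = w a * w b)
    (f : H → ℝ) (h : H) (a : A) : translateSum w f (h * w a) = translateSum w f h := by
  unfold translateSum
  refine Fintype.sum_equiv (Equiv.addLeft a) _ _ fun b => ?_
  simp [hw, mul_assoc]

variable [Fintype H]

theorem sum_mul_right_eq (f : H → ℝ) (k : H) : ∑ h, f (h * k) = ∑ h, f h :=
  Fintype.sum_equiv (Equiv.mulRight k) _ _ fun _ => rfl

/-- Averaging over translations by `w` is self-adjoint on functions that are invariant under these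
translations. -/
theorem sum_mul_translateSum {w : A → H} {g : H → ℝ} (hg : ∀ h a, g (h * w a) = g h)
    (f : H → ℝ) : ∑ h, g h * translateSum w f h = Fintype.card A * ∑ h, g h * f h := by
  have h1 : ∀ a, ∑ h, g h * f (h * w a) = ∑ h, g h * f h := fun a => by
    rw [← sum_mul_right_eq (fun h => g h * f h) (w a)]
    exact Finset.sum_congr rfl fun h _ => by rw [hg]
  simp only [translateSum, Finset.mul_sum]
  rw [Finset.sum_comm]
  simp only [← Finset.mul_sum, h1]
  rw [Finset.sum_const, Finset.card_univ, nsmul_eq_mul]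

theorem sum_translateSum (w : A → H) (f : H → ℝ) :
    ∑ h, translateSum w f h = Fintype.card A * ∑ h, f h := by
  simpa using sum_mul_translateSum (w := w) (g := fun _ => 1) (fun _ _ => rfl) f

theorem sum_sq_translateSum [AddGroup A] {w : A → H} (hw : ∀ a b, w (a + b) = w a * w b)
    (f : H → ℝ) :
    ∑ h, translateSum w f h ^ 2 = Fintype.card A * ∑ h, translateSum w f h * f h := by
  rw [← sum_mul_translateSum (translateSum_apply_mul hw f)]
  exact Finset.sum_congr rfl fun h _ => sq _

end TranslateSum

/-! ### The spectral gap of a Heisenberg group -/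

section Heisenberg

/-- A group of Heisenberg type over the field `F`: it is generated by the images of two
homomorphisms `x` and `y` from the plane `F × F`, whose commutators are the values of a biadditive
and `F`-balanced map `z` into the centre. The maps need not be injective; `z` may be trivial. -/
structure IsHeisenberg {F H : Type*} [Field F] [Group H] (x y : F × F → H)
    (z : F × F → F × F → H) : Prop where
  x_add : ∀ a b, x (a + b) = x a * x b
  y_add : ∀ a b, y (a + b) = y a * y b
  z_add_left : ∀ a a' b, z (a + a') b = z a b * z a' b
  z_add_right : ∀ a b b', z a (b + b') = z a b * z a b'
  z_smul : ∀ (c : F) a b, z a (c • b) = z (c • a) b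
  z_central : ∀ a b g, g * z a b = z a b * g
  comm : ∀ a b, y b * x a = x a * y b * z a b
  generate : Subgroup.closure (Set.range x ∪ Set.range y) = ⊤

namespace IsHeisenberg

variable {F H : Type*} [Field F] [Group H] {x y : F × F → H} {z : F × F → F × F → H}

theorem z_zero_right (hH : IsHeisenberg x y z) (a : F × F) : z a 0 = 1 := by
  have := hH.z_add_right a 0 0
  rw [add_zero] at this
  exact (left_eq_mul.mp this)

theorem z_neg_left (hH : IsHeisenberg x y z) (a b : F × F) : z (-a) b = (z a b)⁻¹ := by
  have h0 : z 0 b = 1 := by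
    have := hH.z_add_left 0 0 b
    rw [add_zero] at this
    exact (left_eq_mul.mp this)
  have := hH.z_add_left (-a) a b
  rw [neg_add_cancel, h0] at this
  exact eq_inv_of_mul_eq_one_left this.symm

/-- The homomorphism from the tensor square of the plane that is induced by `z`, with the tensor
square written in coordinates of its second factor. -/
def zeta (z : F × F → F × F → H) (w : (F × F) × (F × F)) : H := z w.1 (1, 0) * z w.2 (0, 1)

theorem zeta_add (hH : IsHeisenberg x y z) (w w' : (F × F) × (F × F)) :
    zeta z (w + w') = zeta z w * zeta z w' := by
  simp only [zeta, Prod.fst_add, Prod.snd_add, hH.z_add_left]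
  rw [mul_assoc, mul_assoc]
  congr 1
  rw [← mul_assoc, ← mul_assoc, hH.z_central w'.1 (1, 0)]

theorem zeta_central (hH : IsHeisenberg x y z) (w : (F × F) × (F × F)) (g : H) :
    g * zeta z w = zeta z w * g := by
  rw [zeta, ← mul_assoc, hH.z_central w.1, mul_assoc, hH.z_central w.2, ← mul_assoc]

theorem z_eq_zeta (hH : IsHeisenberg x y z) (a b : F × F) : z a b = zeta z (b.1 • a, b.2 • a) := by
  have hb : b = b.1 • ((1, 0) : F × F) + b.2 • ((0, 1) : F × F) := by ext <;> simp
  conv_lhs => rw [hb]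
  rw [hH.z_add_right, hH.z_smul, hH.z_smul, zeta]

variable [Fintype F]

theorem translateSum_z_zero (hH : IsHeisenberg x y z) (f : H → ℝ) (h : H) :
    translateSum (z · 0) f h = (Fintype.card (F × F) : ℝ) * f h :=
  translateSum_of_invariant (fun h a => by rw [hH.z_zero_right, mul_one]) h

/-- Averages over two proportional directions: one of them is redundant. -/
theorem translateSum_z_smul (hH : IsHeisenberg x y z) (f : H → ℝ) (b : F × F) (c : F) (h : H) :
    translateSum (z · b) (translateSum (z · (c • b)) f) h =
      (Fintype.card (F × F) : ℝ) * translateSum (z · b) f h := by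
  have h1 : translateSum (z · b) (translateSum (z · (c • b)) f) h =
      ∑ a', ∑ a, f (h * z a b * z (c • a') b) := by
    simp only [translateSum, hH.z_smul]
    exact Finset.sum_comm
  have h2 : ∀ a', ∑ a, f (h * z a b * z (c • a') b) = translateSum (z · b) f h := by
    intro a'
    refine Fintype.sum_equiv (Equiv.addRight (c • a')) _ _ fun a => ?_
    simp [hH.z_add_left, mul_assoc]
  rw [h1, Finset.sum_congr rfl fun a' _ => h2 a']
  simp

/-- Averages over two independent directions give the average over the whole group of
commutators. -/
theorem translateSum_z_independent (hH : IsHeisenberg x y z) (f : H → ℝ) {b b' : F × F}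
    (hb : b.1 * b'.2 - b.2 * b'.1 ≠ 0) (h : H) :
    translateSum (z · b) (translateSum (z · b') f) h = translateSum (zeta z) f h := by
  simp only [translateSum]
  rw [← Fintype.sum_prod_type' (f := fun a a' => f (h * z a b * z a' b'))]
  have hinj : Function.Injective fun w : (F × F) × (F × F) =>
      (b.1 • w.1 + b'.1 • w.2, b.2 • w.1 + b'.2 • w.2) := by
    intro w w' hww
    obtain ⟨h1, h2⟩ := Prod.mk.inj hww
    have e1 : (b.1 * b'.2 - b.2 * b'.1) • (w.1 - w'.1) = 0 := by
      linear_combination (norm := module) b'.2 • h1 - b'.1 • h2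
    have e2 : (b.1 * b'.2 - b.2 * b'.1) • (w.2 - w'.2) = 0 := by
      linear_combination (norm := module) b.1 • h2 - b.2 • h1
    exact Prod.ext (sub_eq_zero.mp ((smul_eq_zero.mp e1).resolve_left hb))
      (sub_eq_zero.mp ((smul_eq_zero.mp e2).resolve_left hb))
  refine Fintype.sum_bijective _ (Finite.injective_iff_bijective.mp hinj) _ _ fun w => ?_
  have e : z w.1 b * z w.2 b' =
      zeta z (b.1 • w.1 + b'.1 • w.2, b.2 • w.1 + b'.2 • w.2) := by
    rw [hH.z_eq_zeta w.1 b, hH.z_eq_zeta w.2 b', ← hH.zeta_add]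
    rfl
  rw [mul_assoc, e]

/-- The sum over all `b` of the averages in direction `b` satisfies a quadratic equation on the
functions whose average over the group of commutators vanishes, because the composition of two of
these averages is known in each case. -/
theorem sum_translateSum_sq (hH : IsHeisenberg x y z) {f : H → ℝ}
    (hf : ∀ h, translateSum (zeta z) f h = 0) (h : H) :
    ∑ b, translateSum (z · b) (fun h' => ∑ b', translateSum (z · b') f h') h =
      (Fintype.card (F × F) : ℝ) * ((Fintype.card F : ℝ) + 1) * ∑ b, translateSum (z · b) f h -
      (Fintype.card F : ℝ) * (Fintype.card (F × F) : ℝ) ^ 2 * f h := by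
  classical
  set Q : ℝ := (Fintype.card (F × F) : ℝ)
  have h1 : ∀ b, translateSum (z · b) (fun h' => ∑ b', translateSum (z · b') f h') h =
      ∑ b', translateSum (z · b) (translateSum (z · b') f) h := fun b => by
    simp only [translateSum]
    rw [Finset.sum_comm]
  have h2 : ∀ b, b ≠ 0 → ∑ b', translateSum (z · b) (translateSum (z · b') f) h =
      Fintype.card F * (Q * translateSum (z · b) f h) := by
    intro b hb
    rw [← Fintype.sum_of_injective (fun c : F => c • b) (smul_left_injective F hb)
      (fun c => translateSum (z · b) (translateSum (z · (c • b)) f) h)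
      (fun b' => translateSum (z · b) (translateSum (z · b') f) h) ?_ fun _ => rfl]
    · simp only [hH.translateSum_z_smul]
      rw [Finset.sum_const, Finset.card_univ, nsmul_eq_mul]
    · intro b' hb'
      rw [hH.translateSum_z_independent f _ h, hf]
      intro hdet
      apply hb'
      have hb'' : b.1 ≠ 0 ∨ b.2 ≠ 0 := by
        by_contra hcon
        push Not at hcon
        exact hb (Prod.ext hcon.1 hcon.2)
      rcases hb'' with h0 | h0
      · refine ⟨b'.1 / b.1, Prod.ext ?_ ?_⟩
        · simp only [Prod.smul_fst, smul_eq_mul]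
          field_simp
        · simp only [Prod.smul_snd, smul_eq_mul]
          field_simp
          linear_combination -hdet
      · refine ⟨b'.2 / b.2, Prod.ext ?_ ?_⟩
        · simp only [Prod.smul_fst, smul_eq_mul]
          field_simp
          linear_combination hdet
        · simp only [Prod.smul_snd, smul_eq_mul]
          field_simp
  have h3 : ∑ b', translateSum (z · 0) (translateSum (z · b') f) h =
      Q * ∑ b', translateSum (z · b') f h := by
    rw [Finset.mul_sum]
    exact Finset.sum_congr rfl fun b' _ => hH.translateSum_z_zero _ h
  simp only [h1]
  have h4 := Finset.add_sum_erase Finset.univ (fun b => translateSum (z · b) f h)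
    (Finset.mem_univ (0 : F × F))
  rw [← Finset.add_sum_erase Finset.univ _ (Finset.mem_univ (0 : F × F)), h3,
    Finset.sum_congr rfl fun b hb => h2 b (Finset.ne_of_mem_erase hb), ← Finset.mul_sum,
    ← Finset.mul_sum]
  rw [hH.translateSum_z_zero] at h4
  rw [← h4]
  ring

variable [Fintype H]

/-- The averages in the directions `b` sum up to at most the order of `F`, on the functions whose
average over the group of commutators vanishes. -/
theorem sum_translateSum_mul_le (hH : IsHeisenberg x y z) {f : H → ℝ}
    (hf : ∀ h, translateSum (zeta z) f h = 0) :
    ∑ h, (∑ b, translateSum (z · b) f h) * f h ≤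
      (Fintype.card F : ℝ) * (Fintype.card (F × F) : ℝ) * ∑ h, f h ^ 2 := by
  set Q : ℝ := (Fintype.card (F × F) : ℝ)
  set q : ℝ := (Fintype.card F : ℝ)
  have hq : 1 ≤ q := Nat.one_le_cast.mpr Fintype.card_pos
  have hQ : 0 ≤ Q := Nat.cast_nonneg _
  set T : (H → ℝ) → H → ℝ := fun f h => ∑ b, translateSum (z · b) f h with hT
  have adj : ∀ f g : H → ℝ, ∑ h, T f h * g h = ∑ h, f h * T g h := by
    intro f g
    have e1 : ∀ f g : H → ℝ, ∑ h, T f h * g h = ∑ b, ∑ a, ∑ h, f (h * z a b) * g h := by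
      intro f g
      simp only [hT, translateSum, Finset.sum_mul]
      rw [Finset.sum_comm]
      exact Finset.sum_congr rfl fun b _ => Finset.sum_comm
    have e2 : ∑ h, f h * T g h = ∑ h, T g h * f h :=
      Finset.sum_congr rfl fun h _ => mul_comm _ _
    rw [e2, e1, e1]
    refine Finset.sum_congr rfl fun b _ => ?_
    refine Fintype.sum_equiv (Equiv.neg _) _ _ fun a => ?_
    rw [← sum_mul_right_eq (fun h => f (h * z a b) * g h) (z a b)⁻¹]
    refine Finset.sum_congr rfl fun h _ => ?_
    rw [inv_mul_cancel_right, Equiv.neg_apply, hH.z_neg_left, mul_comm]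
  set N : ℝ := ∑ h, f h ^ 2 with hN
  set X : ℝ := ∑ h, T f h * f h with hX
  have hN0 : 0 ≤ N := Finset.sum_nonneg fun h _ => sq_nonneg _
  have hTT : ∑ h, T f h ^ 2 = Q * (q + 1) * X - q * Q ^ 2 * N := by
    calc ∑ h, T f h ^ 2 = ∑ h, T (T f) h * f h := by
          rw [adj (T f) f]
          exact Finset.sum_congr rfl fun h _ => sq _
      _ = ∑ h, (Q * (q + 1) * (T f h * f h) - q * Q ^ 2 * f h ^ 2) := by
          refine Finset.sum_congr rfl fun h _ => ?_
          have := hH.sum_translateSum_sq hf h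
          change T (T f) h = Q * (q + 1) * T f h - q * Q ^ 2 * f h at this
          rw [this]; ring
      _ = _ := by rw [Finset.sum_sub_distrib, ← Finset.mul_sum, ← Finset.mul_sum]
  have hCS : X ^ 2 ≤ (∑ h, T f h ^ 2) * N := Finset.sum_mul_sq_le_sq_mul_sq _ _ _
  rw [hTT] at hCS
  -- the Cauchy-Schwarz inequality now reads `(X - Q N) (X - q Q N) ≤ 0`
  by_contra hlt
  push Not at hlt
  have h1 : 0 < X - q * Q * N := by linarith
  have h2 : Q * N ≤ q * Q * N := by
    rw [mul_assoc]; exact le_mul_of_one_le_left (mul_nonneg hQ hN0) hq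
  have h3 : 0 < X - Q * N := by linarith
  nlinarith [mul_pos h1 h3]

/-- For a function `f` that is invariant under `x`, the correlation of `f` with its translate by
`y b` does not change when this translate is moved by a commutator `z a b`. Hence it is at most the
correlation of `f` with its average over these commutators. -/
theorem card_mul_sum_translate_le (hH : IsHeisenberg x y z) {f : H → ℝ}
    (hf : ∀ h a, f (h * x a) = f h) (b : F × F) :
    (Fintype.card (F × F) : ℝ) * ∑ h, f (h * y b) * f h ≤ ∑ h, translateSum (z · b) f h * f h := by
  set Q : ℝ := (Fintype.card (F × F) : ℝ) with hQdef
  have hQ : 0 < Q := Nat.cast_pos.mpr Fintype.card_pos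
  have h1 : ∀ a, ∑ h, f (h * y b * z a b) * f h = ∑ h, f (h * y b) * f h := by
    intro a
    rw [← sum_mul_right_eq (fun h => f (h * y b * z a b) * f h) (x a)]
    refine Finset.sum_congr rfl fun h _ => ?_
    have : h * x a * y b * z a b = h * y b * x a := by
      rw [mul_assoc h (y b), hH.comm]; simp only [mul_assoc]
    rw [this, hf, hf]
  have h2 : Q * ∑ h, f (h * y b) * f h = ∑ h, translateSum (z · b) f (h * y b) * f h := by
    simp only [translateSum, Finset.sum_mul]
    rw [Finset.sum_comm, Finset.sum_congr rfl fun a _ => h1 a, Finset.sum_const,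
      Finset.card_univ, nsmul_eq_mul]
  have hadd : ∀ a a', z (a + a') b = z a b * z a' b := fun a a' => hH.z_add_left a a' b
  set g := translateSum (z · b) f with hg
  have h3 : Q * ∑ h, g (h * y b) * f h = ∑ h, g (h * y b) * g h := by
    rw [hg, hQdef]
    refine (sum_mul_translateSum (w := (z · b)) (g := fun h => translateSum (z · b) f (h * y b))
      (fun h a => ?_) f).symm
    rw [mul_assoc, ← hH.z_central, ← mul_assoc, translateSum_apply_mul hadd]
  have h4 : ∑ h, g h ^ 2 = Q * ∑ h, g h * f h := sum_sq_translateSum hadd f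
  have h5 : ∑ h, g (h * y b) * g h ≤ ∑ h, g h ^ 2 := by
    have h6 := sum_mul_right_eq (fun h => g h ^ 2) (y b)
    have h7 : ∑ h, g (h * y b) * g h ≤ ∑ h, (g (h * y b) ^ 2 / 2 + g h ^ 2 / 2) :=
      Finset.sum_le_sum fun h _ => by nlinarith [sq_nonneg (g (h * y b) - g h)]
    rw [Finset.sum_add_distrib, ← Finset.sum_div, ← Finset.sum_div, h6] at h7
    linarith
  rw [h2]
  rw [← h3, h4] at h5
  exact le_of_mul_le_mul_left h5 hQ

/-- The average over `y` is a strong contraction on the functions that are invariant under `x` and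
average to zero over the group of commutators. -/
theorem sum_sq_translateSum_y_le (hH : IsHeisenberg x y z) {f : H → ℝ}
    (hfx : ∀ h a, f (h * x a) = f h) (hf : ∀ h, translateSum (zeta z) f h = 0) :
    ∑ h, translateSum y f h ^ 2 ≤
      (Fintype.card (F × F) : ℝ) * (Fintype.card F : ℝ) * ∑ h, f h ^ 2 := by
  have hQ : 0 < (Fintype.card (F × F) : ℝ) := Nat.cast_pos.mpr Fintype.card_pos
  rw [sum_sq_translateSum hH.y_add, mul_assoc]
  refine mul_le_mul_of_nonneg_left ?_ hQ.le
  refine le_of_mul_le_mul_left ?_ hQ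
  calc (Fintype.card (F × F) : ℝ) * ∑ h, translateSum y f h * f h
      = ∑ b, (Fintype.card (F × F) : ℝ) * ∑ h, f (h * y b) * f h := by
        rw [← Finset.mul_sum]
        simp only [translateSum, Finset.sum_mul]
        rw [Finset.sum_comm]
    _ ≤ ∑ b, ∑ h, translateSum (z · b) f h * f h :=
        Finset.sum_le_sum fun b _ => hH.card_mul_sum_translate_le hfx b
    _ = ∑ h, (∑ b, translateSum (z · b) f h) * f h := by
        rw [Finset.sum_comm]
        simp only [Finset.sum_mul]
    _ ≤ _ := hH.sum_translateSum_mul_le hf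
    _ = _ := by ring

/-- The Heisenberg group modulo its commutators is abelian, so on functions of mean zero that are
invariant under `x` and under commutators the average over `y` vanishes. -/
theorem translateSum_y_eq_zero (hH : IsHeisenberg x y z) {g : H → ℝ}
    (hgx : ∀ h a, g (h * x a) = g h) (hgz : ∀ h w, g (h * zeta z w) = g h) (h0 : ∑ h, g h = 0)
    (h : H) : translateSum y g h = 0 := by
  have hinv : ∀ k h, translateSum y g (h * k) = translateSum y g h := by
    intro k
    have hk : k ∈ Subgroup.closure (Set.range x ∪ Set.range y) := hH.generate ▸ Subgroup.mem_top k
    induction hk using Subgroup.closure_induction with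
    | mem k hk =>
      rcases hk with ⟨a, rfl⟩ | ⟨b, rfl⟩
      · intro h
        refine Finset.sum_congr rfl fun b _ => ?_
        have e : h * x a * y b * zeta z (b.1 • a, b.2 • a) = h * y b * x a := by
          rw [← hH.z_eq_zeta, mul_assoc h (y b), hH.comm]; simp only [mul_assoc]
        rw [← hgz (h * x a * y b) (b.1 • a, b.2 • a), e, hgx]
      · exact fun h => translateSum_apply_mul hH.y_add g h b
    | one => simp
    | mul k k' _ _ ih ih' => exact fun h => by rw [← mul_assoc, ih', ih]
    | inv k _ ih => exact fun h => by rw [← ih (h * k⁻¹), inv_mul_cancel_right]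
  have h1 : ∀ k, translateSum y g k = translateSum y g h := fun k => by
    rw [← hinv (h⁻¹ * k) h, mul_inv_cancel_left]
  have h2 := sum_translateSum y g
  rw [h0, mul_zero, Finset.sum_congr rfl fun k _ => h1 k, Finset.sum_const, nsmul_eq_mul] at h2
  refine (mul_eq_zero.mp h2).resolve_left ?_
  have : 0 < Fintype.card H := Fintype.card_pos
  exact_mod_cast this.ne'

/-- The spectral gap of the bipartite coset graph of a Heisenberg group, in terms of functions:
the cosine of the angle between the functions of mean zero invariant under `x` and the functions
invariant under `y` is at most `1 / √|F|`. -/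
theorem card_mul_sq_sum_mul_le (hH : IsHeisenberg x y z) {f g : H → ℝ}
    (hfx : ∀ h a, f (h * x a) = f h) (hgy : ∀ h b, g (h * y b) = g h) (h0 : ∑ h, f h = 0) :
    (Fintype.card F : ℝ) * (∑ h, f h * g h) ^ 2 ≤ (∑ h, f h ^ 2) * ∑ h, g h ^ 2 := by
  set q : ℝ := (Fintype.card F : ℝ) with hq
  have hq0 : 0 < q := Nat.cast_pos.mpr Fintype.card_pos
  have hQ : (Fintype.card (F × F) : ℝ) = q ^ 2 := by
    rw [Fintype.card_prod]; push_cast; rw [sq]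
  set Z : ℝ := (Fintype.card ((F × F) × (F × F)) : ℝ) with hZ
  have hZ0 : 0 < Z := Nat.cast_pos.mpr Fintype.card_pos
  -- split `f` into its average `f₁` over the commutators and the rest `f₂`
  set f₁ : H → ℝ := translateSum (zeta z) f with hf₁
  set f₂ : H → ℝ := fun h => f h - Z⁻¹ * f₁ h with hf₂
  have hf₁z : ∀ h w, f₁ (h * zeta z w) = f₁ h := translateSum_apply_mul hH.zeta_add f
  have hf₁x : ∀ h a, f₁ (h * x a) = f₁ h := fun h a => by
    refine Finset.sum_congr rfl fun w _ => ?_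
    rw [mul_assoc, hH.zeta_central, ← mul_assoc, hfx]
  have hf₂x : ∀ h a, f₂ (h * x a) = f₂ h := fun h a => by simp only [hf₂, hfx, hf₁x]
  have hf₂z : ∀ h, translateSum (zeta z) f₂ h = 0 := fun h => by
    have h1 := translateSum_of_invariant hf₁z h
    have h2 : translateSum (zeta z) f₂ h = f₁ h - Z⁻¹ * translateSum (zeta z) f₁ h := by
      simp only [hf₁, hf₂, translateSum, Finset.sum_sub_distrib, ← Finset.mul_sum]
    rw [h2, h1, ← hZ]
    field_simp
    ring
  have hy₁ : ∀ h, translateSum y f₁ h = 0 :=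
    hH.translateSum_y_eq_zero hf₁x hf₁z (by rw [sum_translateSum, h0, mul_zero])
  have hy₂ : ∀ h, translateSum y f h = translateSum y f₂ h := fun h => by
    have h2 : translateSum y f₂ h = translateSum y f h - Z⁻¹ * translateSum y f₁ h := by
      simp only [hf₂, translateSum, Finset.sum_sub_distrib, ← Finset.mul_sum]
    rw [h2, hy₁, mul_zero, sub_zero]
  have hnorm : ∑ h, f₂ h ^ 2 ≤ ∑ h, f h ^ 2 := by
    have h1 : ∑ h, f₁ h * f₂ h = 0 := by
      have h2 := sum_mul_translateSum hf₁z f₂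
      simp only [hf₂z, mul_zero, Finset.sum_const_zero] at h2
      exact (mul_eq_zero.mp h2.symm).resolve_left hZ0.ne'
    have h2 : ∑ h, f h ^ 2 = ∑ h, f₂ h ^ 2 + 2 * Z⁻¹ * ∑ h, f₁ h * f₂ h +
        Z⁻¹ ^ 2 * ∑ h, f₁ h ^ 2 := by
      simp only [Finset.mul_sum, ← Finset.sum_add_distrib]
      exact Finset.sum_congr rfl fun h _ => by simp only [hf₂]; ring
    rw [h2, h1]
    have : 0 ≤ ∑ h, f₁ h ^ 2 := Finset.sum_nonneg fun h _ => sq_nonneg _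
    have : 0 ≤ Z⁻¹ ^ 2 * ∑ h, f₁ h ^ 2 := mul_nonneg (sq_nonneg _) this
    linarith
  have hmain := hH.sum_sq_translateSum_y_le hf₂x hf₂z
  rw [hQ, ← hq] at hmain
  have hadj := sum_mul_translateSum hgy f
  rw [hQ] at hadj
  have hfg : ∑ h, f h * g h = ∑ h, g h * f h := Finset.sum_congr rfl fun h _ => mul_comm _ _
  have hCS : (∑ h, g h * translateSum y f h) ^ 2 ≤
      (∑ h, g h ^ 2) * ∑ h, translateSum y f h ^ 2 := Finset.sum_mul_sq_le_sq_mul_sq _ _ _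
  rw [hadj] at hCS
  simp only [hy₂] at hCS
  have hG : 0 ≤ ∑ h, g h ^ 2 := Finset.sum_nonneg fun h _ => sq_nonneg _
  rw [hfg]
  refine le_of_mul_le_mul_left ?_ (pow_pos hq0 3)
  calc q ^ 3 * (q * (∑ h, g h * f h) ^ 2) = (q ^ 2 * ∑ h, g h * f h) ^ 2 := by ring
    _ ≤ (∑ h, g h ^ 2) * ∑ h, translateSum y f₂ h ^ 2 := hCS
    _ ≤ (∑ h, g h ^ 2) * (q ^ 2 * q * ∑ h, f h ^ 2) :=
        mul_le_mul_of_nonneg_left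
          (hmain.trans (mul_le_mul_of_nonneg_left hnorm (by positivity))) hG
    _ = _ := by ring

end IsHeisenberg

end Heisenberg

/-! ### Spectral gaps of coset complexes -/

section CosetComplex

variable {Γ ι : Type*} [Group Γ] (K : ι → Subgroup Γ)

/-- The stabilizer of a face of type `τ` through the identity: the intersection of the subgroups
`K i` with `i ∈ τ`. -/
def typeStabilizer (τ : Finset ι) : Subgroup Γ := ⨅ i ∈ τ, K i

variable {K}

theorem mem_typeStabilizer {τ : Finset ι} {g : Γ} :
    g ∈ typeStabilizer K τ ↔ ∀ i ∈ τ, g ∈ K i := by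
  simp [typeStabilizer, Subgroup.mem_iInf]

variable [Fintype ι]

variable (K) in
/-- The top face of the coset complex formed by the cosets of `g`. -/
def cosetFace (g : Γ) : Finset (Σ i : ι, Γ ⧸ K i) :=
  Finset.univ.map ⟨fun i => ⟨i, (g : Γ ⧸ K i)⟩, fun _ _ h => congrArg Sigma.fst h⟩

theorem mem_cosetFace {g : Γ} {v : Σ i : ι, Γ ⧸ K i} :
    v ∈ cosetFace K g ↔ v.2 = (g : Γ ⧸ K v.1) := by
  constructor
  · intro h
    obtain ⟨i, -, rfl⟩ := Finset.mem_map.mp h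
    rfl
  · obtain ⟨i, x⟩ := v
    rintro h
    exact Finset.mem_map.mpr ⟨i, Finset.mem_univ i, Sigma.ext rfl (heq_of_eq h.symm)⟩

theorem mk_mem_cosetFace {g : Γ} {i : ι} : (⟨i, (g : Γ ⧸ K i)⟩ : Σ i, Γ ⧸ K i) ∈ cosetFace K g :=
  mem_cosetFace.mpr rfl

theorem card_cosetFace (g : Γ) : (cosetFace K g).card = Fintype.card ι := by
  rw [cosetFace, Finset.card_map, Finset.card_univ]

theorem mem_faces_cosetComplex {S : Finset (Σ i : ι, Γ ⧸ K i)} :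
    S ∈ (cosetComplex K).faces ↔ ∃ g, S ⊆ cosetFace K g :=
  exists_congr fun _ => forall₂_congr fun _ _ => mem_cosetFace.symm

theorem hasDim_cosetComplex {n : ℕ} (hι : Fintype.card ι = n + 1) :
    (cosetComplex K).HasDim n := by
  refine ⟨⟨cosetFace K 1, mem_faces_cosetComplex.mpr ⟨1, subset_rfl⟩, ?_⟩, fun S hS => ?_⟩
  · rw [card_cosetFace, hι]
  · obtain ⟨g, hg⟩ := mem_faces_cosetComplex.mp hS
    rw [← hι, ← card_cosetFace (K := K) g]
    exact Finset.card_le_card hg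

theorem isPure_cosetComplex {n : ℕ} (hι : Fintype.card ι = n + 1) :
    (cosetComplex K).IsPure n := by
  intro S hS
  obtain ⟨g, hg⟩ := mem_faces_cosetComplex.mp hS
  exact ⟨_, mem_faces_cosetComplex.mpr ⟨g, subset_rfl⟩, hg, by rw [card_cosetFace, hι]⟩

theorem mem_facesOfCard_cosetComplex [Finite (Σ i : ι, Γ ⧸ K i)] {n : ℕ}
    (hι : Fintype.card ι = n + 1) {T : Finset (Σ i : ι, Γ ⧸ K i)} :
    T ∈ (cosetComplex K).facesOfCard (n + 1) ↔ ∃ g, cosetFace K g = T := by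
  rw [FaceComplex.mem_facesOfCard, mem_faces_cosetComplex]
  constructor
  · rintro ⟨⟨g, hg⟩, hc⟩
    exact ⟨g, (Finset.eq_of_subset_of_card_le hg (by rw [card_cosetFace, hι, hc])).symm⟩
  · rintro ⟨g, rfl⟩
    exact ⟨⟨g, subset_rfl⟩, by rw [card_cosetFace, hι]⟩

theorem cosetFace_injective (hK : ⨅ i, K i = ⊥) : Function.Injective (cosetFace K) := by
  intro g h hgh
  have : g⁻¹ * h ∈ ⨅ i, K i := Subgroup.mem_iInf.mpr fun i => by
    have h1 : (⟨i, (g : Γ ⧸ K i)⟩ : Σ i, Γ ⧸ K i) ∈ cosetFace K h := hgh ▸ mk_mem_cosetFace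
    exact QuotientGroup.eq.mp (mem_cosetFace.mp h1)
  rw [hK, Subgroup.mem_bot] at this
  exact inv_mul_eq_one.mp this

/-- The set of types of the elements of a face. -/
def faceType [DecidableEq ι] (S : Finset (Σ i : ι, Γ ⧸ K i)) : Finset ι := S.image Sigma.fst

section FaceType

variable [DecidableEq ι] {S : Finset (Σ i : ι, Γ ⧸ K i)} {g₀ : Γ}

theorem mem_face_iff_of_subset (hS : S ⊆ cosetFace K g₀) {v : Σ i : ι, Γ ⧸ K i}
    (hv : v ∈ cosetFace K g₀) : v ∈ S ↔ v.1 ∈ faceType S := by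
  constructor
  · exact fun h => Finset.mem_image_of_mem _ h
  · intro h
    obtain ⟨⟨i, y⟩, hw, hwv⟩ := Finset.mem_image.mp h
    obtain ⟨j, x⟩ := v
    obtain rfl : i = j := hwv
    have h1 := mem_cosetFace.mp (hS hw)
    have h2 := mem_cosetFace.mp hv
    dsimp only at h1 h2
    rw [h2, ← h1]
    exact hw

theorem card_faceType (hS : S ⊆ cosetFace K g₀) : (faceType S).card = S.card := by
  refine Finset.card_image_of_injOn fun v hv w hw hvw => ?_
  obtain ⟨i, x⟩ := v
  obtain ⟨j, y⟩ := w
  obtain rfl : i = j := hvw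
  have h1 := mem_cosetFace.mp (hS hv)
  have h2 := mem_cosetFace.mp (hS hw)
  dsimp only at h1 h2
  rw [h1, h2]

theorem subset_cosetFace_iff (hS : S ⊆ cosetFace K g₀) {g : Γ} :
    S ⊆ cosetFace K g ↔ g₀⁻¹ * g ∈ typeStabilizer K (faceType S) := by
  rw [mem_typeStabilizer]
  constructor
  · intro h i hi
    obtain ⟨v, hv, rfl⟩ := Finset.mem_image.mp hi
    exact QuotientGroup.eq.mp ((mem_cosetFace.mp (hS hv)).symm.trans (mem_cosetFace.mp (h hv)))
  · intro h v hv
    rw [mem_cosetFace, mem_cosetFace.mp (hS hv)]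
    exact QuotientGroup.eq.mpr (h _ (Finset.mem_image_of_mem _ hv))

end FaceType

variable [Fintype (Σ i : ι, Γ ⧸ K i)] {n : ℕ}

/-- The link of a face of type `τ` is connected if the stabilizer of that face is generated by the
stabilizers of the faces that contain it and one vertex more. -/
theorem linkConnected_cosetComplex [DecidableEq ι] (hι : Fintype.card ι = n + 1)
    (hgen : ∀ τ : Finset ι, τ.card + 3 ≤ Fintype.card ι →
      typeStabilizer K τ ≤ ⨆ i : {i // i ∉ τ}, typeStabilizer K (insert i.1 τ))
    (S : Finset (Σ i : ι, Γ ⧸ K i)) (hSc : S.card + 3 ≤ n + 1) :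
    LinkConnected ((cosetComplex K).facesOfCard (n + 1)) S := by
  intro f hf
  by_cases hface : ∃ g₀, S ⊆ cosetFace K g₀
  swap
  · refine ⟨0, fun u hu => ?_⟩
    obtain ⟨v, -, hv⟩ := Finset.exists_ne_zero_of_sum_ne_zero hu
    obtain ⟨-, -, -, T, hT, hST, -⟩ := linkGraph_ne_zero_iff.mp hv
    obtain ⟨g, rfl⟩ := (mem_facesOfCard_cosetComplex hι).mp hT
    exact (hface ⟨g, hST⟩).elim
  obtain ⟨g₀, hS⟩ := hface
  set τ := faceType S
  have hτc : τ.card = S.card := card_faceType hS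
  obtain ⟨i₀, hi₀⟩ : ∃ i₀, i₀ ∉ τ := by
    by_contra hall
    push Not at hall
    have : τ = Finset.univ := Finset.eq_univ_iff_forall.mpr hall
    rw [this, Finset.card_univ] at hτc
    omega
  -- the function `f` is constant on the vertices outside `S` of each face around `S`
  have hedge : ∀ g, S ⊆ cosetFace K g → ∀ i, i ∉ τ → ∀ j, j ∉ τ →
      f ⟨i, (g : Γ ⧸ K i)⟩ = f ⟨j, (g : Γ ⧸ K j)⟩ := by
    intro g hg i hi j hj
    by_cases hij : i = j
    · subst hij; rfl
    · refine hf _ _ (linkGraph_ne_zero_iff.mpr ⟨fun h => hij (congrArg Sigma.fst h),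
        fun h => hi (Finset.mem_image_of_mem Sigma.fst h),
        fun h => hj (Finset.mem_image_of_mem Sigma.fst h), cosetFace K g,
        (mem_facesOfCard_cosetComplex hι).mpr ⟨g, rfl⟩, hg, mk_mem_cosetFace, mk_mem_cosetFace⟩)
  have hsub : ∀ h ∈ typeStabilizer K τ, S ⊆ cosetFace K (g₀ * h) := fun h hh =>
    (subset_cosetFace_iff hS).mpr (by rwa [inv_mul_cancel_left])
  have key : ∀ k ∈ ⨆ i : {i // i ∉ τ}, typeStabilizer K (insert i.1 τ),
      k ∈ typeStabilizer K τ ∧ ∀ h ∈ typeStabilizer K τ,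
        f ⟨i₀, ((g₀ * (h * k) : Γ) : Γ ⧸ K i₀)⟩ = f ⟨i₀, ((g₀ * h : Γ) : Γ ⧸ K i₀)⟩ := by
    intro k hk
    refine Subgroup.iSup_induction _ hk (C := fun k => k ∈ typeStabilizer K τ ∧
      ∀ h ∈ typeStabilizer K τ,
        f ⟨i₀, ((g₀ * (h * k) : Γ) : Γ ⧸ K i₀)⟩ = f ⟨i₀, ((g₀ * h : Γ) : Γ ⧸ K i₀)⟩)
      ?_ ⟨one_mem _, fun h _ => by rw [mul_one]⟩ ?_
    · rintro ⟨i, hi⟩ k hk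
      rw [mem_typeStabilizer] at hk
      have hkτ : k ∈ typeStabilizer K τ :=
        mem_typeStabilizer.mpr fun j hj => hk j (Finset.mem_insert_of_mem hj)
      refine ⟨hkτ, fun h hh => ?_⟩
      rw [hedge _ (hsub _ (mul_mem hh hkτ)) i₀ hi₀ i hi, hedge _ (hsub h hh) i₀ hi₀ i hi]
      congr 2
      refine (QuotientGroup.eq.mpr ?_).symm
      rw [← mul_assoc g₀, inv_mul_cancel_left]
      exact hk i (Finset.mem_insert_self i τ)
    · rintro k k' ⟨hk, hk'⟩ ⟨hl, hl'⟩
      refine ⟨mul_mem hk hl, fun h hh => ?_⟩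
      rw [← mul_assoc h, hl' _ (mul_mem hh hk), hk' h hh]
  refine ⟨f ⟨i₀, (g₀ : Γ ⧸ K i₀)⟩, fun u hu => ?_⟩
  obtain ⟨v, -, hv⟩ := Finset.exists_ne_zero_of_sum_ne_zero hu
  obtain ⟨-, huS, -, T, hT, hST, huT, -⟩ := linkGraph_ne_zero_iff.mp hv
  obtain ⟨g, rfl⟩ := (mem_facesOfCard_cosetComplex hι).mp hT
  have hg := (subset_cosetFace_iff hS).mp hST
  have huτ : u.1 ∉ τ := fun h => huS ((mem_face_iff_of_subset hST huT).mpr h)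
  have h1 := (key _ (hgen τ (by omega) hg)).2 1 (one_mem _)
  rw [mul_one, one_mul, mul_inv_cancel_left] at h1
  rw [← h1, ← hedge g hST _ huτ i₀ hi₀]
  obtain ⟨i, x⟩ := u
  have h2 := mem_cosetFace.mp huT
  dsimp only at h2
  rw [h2]

/-- The spectral gap of a link of codimension two, in terms of functions on the stabilizer `H` of
the face: the link is the bipartite graph of cosets of `H ∩ K i` and `H ∩ K j`. -/
theorem hasSpectralGap_codim_two [DecidableEq ι] [Finite Γ] (hι : Fintype.card ι = n + 1)
    (hK : ⨅ i, K i = ⊥) {q : ℝ} (hq : 0 < q)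
    (S : Finset (Σ i : ι, Γ ⧸ K i)) (g₀ : Γ) (hS : S ⊆ cosetFace K g₀) {i j : ι} (hij : i ≠ j)
    (hc : (faceType S)ᶜ = {i, j})
    (hgap : ∀ [Fintype (typeStabilizer K (faceType S))]
      (φ ψ : typeStabilizer K (faceType S) → ℝ),
      (∀ h k : typeStabilizer K (faceType S), (k : Γ) ∈ K i → φ (h * k) = φ h) →
      (∀ h k : typeStabilizer K (faceType S), (k : Γ) ∈ K j → ψ (h * k) = ψ h) →
      ∑ h, φ h = 0 → q * (∑ h, φ h * ψ h) ^ 2 ≤ (∑ h, φ h ^ 2) * ∑ h, ψ h ^ 2) :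
    HasSpectralGap (linkGraph ((cosetComplex K).facesOfCard (n + 1)) S) (1 / √q) := by
  classical
  set τ := faceType S with hτ
  set 𝓕 := (cosetComplex K).facesOfCard (n + 1)
  have hiτ : i ∉ τ := Finset.mem_compl.mp (hc ▸ by simp)
  have hjτ : j ∉ τ := Finset.mem_compl.mp (hc ▸ by simp)
  have hfin : Fintype (typeStabilizer K τ) := Fintype.ofFinite _
  have hsub : ∀ h : typeStabilizer K τ, S ⊆ cosetFace K (g₀ * h) := fun h =>
    (subset_cosetFace_iff hS).mpr (by rw [inv_mul_cancel_left]; exact h.2)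
  have hdiff : ∀ h : typeStabilizer K τ, cosetFace K (g₀ * h) \ S =
      {⟨i, ((g₀ * h : Γ) : Γ ⧸ K i)⟩, ⟨j, ((g₀ * h : Γ) : Γ ⧸ K j)⟩} := by
    intro h
    ext v
    rw [Finset.mem_sdiff, Finset.mem_insert, Finset.mem_singleton]
    constructor
    · rintro ⟨h1, h2⟩
      rw [mem_face_iff_of_subset (hsub h) h1, ← Finset.mem_compl, hc] at h2
      obtain ⟨l, x⟩ := v
      have h3 := mem_cosetFace.mp h1
      dsimp only at h3
      rcases Finset.mem_insert.mp h2 with h4 | h4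
      · obtain rfl : l = i := h4
        left; rw [h3]
      · obtain rfl : l = j := Finset.mem_singleton.mp h4
        right; rw [h3]
    · rintro (rfl | rfl)
      · exact ⟨mk_mem_cosetFace, fun h' => hiτ (Finset.mem_image_of_mem Sigma.fst h')⟩
      · exact ⟨mk_mem_cosetFace, fun h' => hjτ (Finset.mem_image_of_mem Sigma.fst h')⟩
  have hsum : ∀ G : (Σ i : ι, Γ ⧸ K i) → (Σ i : ι, Γ ⧸ K i) → ℝ,
      ∑ u, ∑ v, linkGraph 𝓕 S u v * G u v = ∑ h : typeStabilizer K τ,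
        (G ⟨i, ((g₀ * h : Γ) : Γ ⧸ K i)⟩ ⟨j, ((g₀ * h : Γ) : Γ ⧸ K j)⟩ +
          G ⟨j, ((g₀ * h : Γ) : Γ ⧸ K j)⟩ ⟨i, ((g₀ * h : Γ) : Γ ⧸ K i)⟩) := by
    intro G
    rw [sum_linkGraph_mul]
    symm
    refine Finset.sum_bij (fun h _ => cosetFace K (g₀ * h)) (fun h _ => ?_) (fun h _ h' _ hh => ?_)
      (fun T hT => ?_) (fun h _ => ?_)
    · exact Finset.mem_filter.mpr ⟨(mem_facesOfCard_cosetComplex hι).mpr ⟨_, rfl⟩, hsub h⟩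
    · exact Subtype.ext (mul_left_cancel (cosetFace_injective hK hh))
    · obtain ⟨hT1, hT2⟩ := Finset.mem_filter.mp hT
      obtain ⟨g, rfl⟩ := (mem_facesOfCard_cosetComplex hι).mp hT1
      exact ⟨⟨g₀⁻¹ * g, (subset_cosetFace_iff hS).mp hT2⟩, Finset.mem_univ _,
        by rw [mul_inv_cancel_left]⟩
    · have hne : (⟨i, ((g₀ * h : Γ) : Γ ⧸ K i)⟩ : Σ i, Γ ⧸ K i) ≠ ⟨j, ((g₀ * h : Γ) : Γ ⧸ K j)⟩ :=
        fun h' => hij (congrArg Sigma.fst h')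
      rw [hdiff, Finset.sum_pair hne, Finset.sum_pair hne, Finset.sum_pair hne]
      simp [hne, hne.symm]
  intro f hf
  set φ : typeStabilizer K τ → ℝ := fun h => f ⟨i, ((g₀ * h : Γ) : Γ ⧸ K i)⟩ with hφ
  set ψ : typeStabilizer K τ → ℝ := fun h => f ⟨j, ((g₀ * h : Γ) : Γ ⧸ K j)⟩ with hψ
  have hinv : ∀ l (h k : typeStabilizer K τ), (k : Γ) ∈ K l →
      f ⟨l, ((g₀ * (h * k : typeStabilizer K τ) : Γ) : Γ ⧸ K l)⟩ =
        f ⟨l, ((g₀ * h : Γ) : Γ ⧸ K l)⟩ := by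
    intro l h k hk
    congr 2
    refine (QuotientGroup.eq.mpr ?_).symm
    rw [Subgroup.coe_mul, ← mul_assoc g₀, inv_mul_cancel_left]
    exact hk
  have e0 : ∑ h, φ h + ∑ h, ψ h = 0 := by
    rw [← Finset.sum_add_distrib, ← hf, ← hsum fun u v => f u]
    exact Finset.sum_congr rfl fun u _ => by rw [Finset.sum_mul]
  have e1 : ∑ u, (∑ v, linkGraph 𝓕 S u v) * f u ^ 2 = ∑ h, φ h ^ 2 + ∑ h, ψ h ^ 2 := by
    rw [← Finset.sum_add_distrib, ← hsum fun u v => f u ^ 2]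
    exact Finset.sum_congr rfl fun u _ => by rw [Finset.sum_mul]
  have e2 : ∑ u, ∑ v, linkGraph 𝓕 S u v * f u * f v = 2 * ∑ h, φ h * ψ h := by
    simp only [mul_assoc]
    rw [hsum fun u v => f u * f v, Finset.mul_sum]
    exact Finset.sum_congr rfl fun h _ => by simp only [hφ, hψ]; ring
  rw [e1, e2]
  -- subtract the mean `m` of `φ`, which is the negative of the mean of `ψ`
  set c : ℝ := (Fintype.card (typeStabilizer K τ) : ℝ) with hcdef
  have hc0 : 0 < c := Nat.cast_pos.mpr Fintype.card_pos
  set m : ℝ := (∑ h, φ h) / c with hm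
  have hmc : c * m = ∑ h, φ h := by rw [hm]; field_simp
  have hmain := hgap (fun h => φ h - m) ψ
    (fun h k hk => by simp only [hφ, hinv i h k hk]) (fun h k hk => hinv j h k hk) (by
      rw [Finset.sum_sub_distrib, Finset.sum_const, Finset.card_univ, nsmul_eq_mul, ← hcdef, hmc,
        sub_self])
  set A := ∑ h, (φ h - m) ^ 2 with hA
  set B := ∑ h, ψ h ^ 2 with hB
  set P := ∑ h, (φ h - m) * ψ h with hP
  have hA1 : A = ∑ h, φ h ^ 2 - c * m ^ 2 := by
    have : A = ∑ h, φ h ^ 2 - 2 * m * ∑ h, φ h + ∑ _h : typeStabilizer K τ, m ^ 2 := by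
      rw [hA, Finset.mul_sum, ← Finset.sum_sub_distrib, ← Finset.sum_add_distrib]
      exact Finset.sum_congr rfl fun h _ => by ring
    rw [this, ← hmc, Finset.sum_const, Finset.card_univ, nsmul_eq_mul, ← hcdef]
    ring
  have hP1 : P = ∑ h, φ h * ψ h + c * m ^ 2 := by
    have : P = ∑ h, φ h * ψ h - m * ∑ h, ψ h := by
      rw [hP, Finset.mul_sum, ← Finset.sum_sub_distrib]
      exact Finset.sum_congr rfl fun h _ => by ring
    rw [this, show ∑ h, ψ h = -(c * m) by linarith]
    ring
  have hcm : 0 ≤ c * m ^ 2 := mul_nonneg hc0.le (sq_nonneg m)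
  have hA0 : 0 ≤ A := Finset.sum_nonneg fun h _ => sq_nonneg _
  have hB0 : 0 ≤ B := Finset.sum_nonneg fun h _ => sq_nonneg _
  have hsq : 0 < √q := Real.sqrt_pos.mpr hq
  have hPAB : 2 * (√q * P) ≤ A + B := by
    refine le_of_abs_le (abs_le_of_sq_le_sq ?_ (add_nonneg hA0 hB0))
    have h1 : (√q * P) ^ 2 ≤ A * B := by
      rw [mul_pow, Real.sq_sqrt hq.le]; exact hmain
    nlinarith [sq_nonneg (A - B)]
  have hfin : 2 * P ≤ 1 / √q * (A + B) := by
    rw [div_mul_eq_mul_div, one_mul, le_div_iff₀ hsq]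
    linarith
  calc 2 * ∑ h, φ h * ψ h ≤ 2 * P := by linarith
    _ ≤ 1 / √q * (A + B) := hfin
    _ ≤ _ := mul_le_mul_of_nonneg_left (by linarith) (by positivity)

end CosetComplex

/-- A coset complex of dimension `n` is a spectral expander if the subgroups `K i` intersect
trivially, if the stabilizers of faces are generated by the stabilizers of larger faces, and if the
links of codimension two have the spectral gap `1 / √q`. -/
theorem cosetComplex_isOnesidedSpectralHDX {Γ ι : Type*} [Group Γ] [Finite Γ] [Fintype ι]
    [DecidableEq ι] {K : ι → Subgroup Γ} [Finite (Σ i : ι, Γ ⧸ K i)] {n : ℕ} (hn : 1 ≤ n)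
    (hι : Fintype.card ι = n + 1) (hK : ⨅ i, K i = ⊥)
    (hgen : ∀ τ : Finset ι, τ.card + 3 ≤ Fintype.card ι →
      typeStabilizer K τ ≤ ⨆ i : {i // i ∉ τ}, typeStabilizer K (insert i.1 τ))
    {q : ℝ} (hq : (n : ℝ) - 1 < √q)
    (hgap : ∀ τ : Finset ι, τ.card + 2 = Fintype.card ι → ∃ i j, i ≠ j ∧ τᶜ = {i, j} ∧
      ∀ [Fintype (typeStabilizer K τ)] (φ ψ : typeStabilizer K τ → ℝ),
        (∀ h k : typeStabilizer K τ, (k : Γ) ∈ K i → φ (h * k) = φ h) →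
        (∀ h k : typeStabilizer K τ, (k : Γ) ∈ K j → ψ (h * k) = ψ h) →
        ∑ h, φ h = 0 → q * (∑ h, φ h * ψ h) ^ 2 ≤ (∑ h, φ h ^ 2) * ∑ h, ψ h ^ 2) :
    (cosetComplex K).IsOnesidedSpectralHDX ((cosetComplex K).uniformWeight n) n
      (1 / (√q - ((n : ℝ) - 1))) := by
  have hd := hasDim_cosetComplex (K := K) hι
  have hp := isPure_cosetComplex (K := K) hι
  refine ⟨hn, FaceComplex.isWeighted_uniformWeight hd hp, fun S hS hSn => ?_⟩
  cases nonempty_fintype (Σ i : ι, Γ ⧸ K i)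
  have hn1 : (1 : ℝ) ≤ n := by exact_mod_cast hn
  have hq0 : 0 < q := Real.sqrt_pos.mp (lt_of_le_of_lt (by linarith) hq)
  have hbase : ∀ S : Finset (Σ i : ι, Γ ⧸ K i), S.card + 2 = n + 1 →
      HasSpectralGap (linkGraph ((cosetComplex K).facesOfCard (n + 1)) S) (1 / √q) := by
    intro S hSc
    by_cases hface : ∃ g₀, S ⊆ cosetFace K g₀
    · obtain ⟨g₀, hg₀⟩ := hface
      obtain ⟨i, j, hij, hc, h⟩ := hgap (faceType S) (by rw [card_faceType hg₀, hι, hSc])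
      exact hasSpectralGap_codim_two hι hK hq0 S g₀ hg₀ hij hc h
    · refine hasSpectralGap_of_not_subset ?_ _
      rintro ⟨T, hT, hST⟩
      obtain ⟨g, rfl⟩ := (mem_facesOfCard_cosetComplex hι).mp hT
      exact hface ⟨g, hST⟩
  have hm : (((n - 1 - S.card : ℕ)) : ℝ) ≤ (n : ℝ) - 1 := by
    rw [le_sub_iff_add_le]
    exact_mod_cast (by omega : n - 1 - S.card + 1 ≤ n)
  have h1 := linkGraph_hasSpectralGap (fun T hT => (FaceComplex.mem_facesOfCard.mp hT).2) hbase
    (linkConnected_cosetComplex hι hgen) (n - 1 - S.card) (lt_of_le_of_lt hm hq) S (by omega)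
  refine FaceComplex.isOnesidedSpectralExpander_link hd hp hS hSn
    (one_div_nonneg.mpr (by linarith)) (h1.mono (linkGraph_nonneg _ _) ?_)
  exact one_div_le_one_div_of_le (by linarith) (by linarith)

/-! ### Cyclic patterns of matrices -/

section CyclicPattern

variable {d : ℕ}

theorem Fin.val_sub_eq_ite (k a : Fin d) :
    (k - a).val = if a ≤ k then k.val - a.val else d + k.val - a.val := by
  split_ifs with h
  · exact Fin.coe_sub_iff_le.mpr h
  · exact Fin.coe_sub_iff_lt.mpr (not_le.mp h)

/-- The cyclic interval from `a` (included) to `b` (excluded) in `Fin d` avoids `σ`. For each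
`k ∈ σ`, this says that `b` does not come before `a` in the linear order
`k + 1, k + 2, ..., k` that is obtained by cutting the cycle after `k`. -/
def CyclicAvoids (σ : Finset (Fin d)) (a b : Fin d) : Prop :=
  ∀ k ∈ σ, (k - b).val ≤ (k - a).val

theorem CyclicAvoids.refl (σ : Finset (Fin d)) (a : Fin d) : CyclicAvoids σ a a :=
  fun _ _ => le_rfl

theorem CyclicAvoids.trans {σ : Finset (Fin d)} {a b c : Fin d} (h : CyclicAvoids σ a b)
    (h' : CyclicAvoids σ b c) : CyclicAvoids σ a c :=
  fun k hk => (h' k hk).trans (h k hk)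

/-- Inside the linear order obtained by cutting the cycle after `i`, the cyclic intervals behave as
intervals of that order: if the interval from `a` to `c` avoids `σ`, so do the two parts into which
it is divided by `b`. -/
theorem CyclicAvoids.split {σ : Finset (Fin d)} {i a b c : Fin d}
    (hab : (i - b).val ≤ (i - a).val) (hbc : (i - c).val ≤ (i - b).val)
    (h : CyclicAvoids σ a c) : CyclicAvoids σ a b ∧ CyclicAvoids σ b c := by
  have key : ∀ k ∈ σ, (k - b).val ≤ (k - a).val ∧ (k - c).val ≤ (k - b).val := by
    intro k hk
    have h1 := h k hk
    simp only [Fin.val_sub_eq_ite, Fin.le_def] at hab hbc h1 ⊢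
    have := i.isLt
    have := a.isLt
    have := b.isLt
    have := c.isLt
    have := k.isLt
    split_ifs at * <;> omega
  exact ⟨fun k hk => (key k hk).1, fun k hk => (key k hk).2⟩

variable {R : Type*} [CommRing R]

/-- The entry of `M` at `(a, b)` vanishes unless the cyclic interval from `a` to `b` avoids `σ`. -/
def HasCyclicPattern (σ : Finset (Fin d)) (M : Matrix (Fin d) (Fin d) R) : Prop :=
  ∀ a b, M a b ≠ 0 → CyclicAvoids σ a b

theorem HasCyclicPattern.one (σ : Finset (Fin d)) :
    HasCyclicPattern σ (1 : Matrix (Fin d) (Fin d) R) := by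
  intro a b hab
  by_cases h : a = b
  · exact h ▸ CyclicAvoids.refl σ a
  · exact (hab (Matrix.one_apply_ne h)).elim

theorem HasCyclicPattern.mul {σ : Finset (Fin d)} {M N : Matrix (Fin d) (Fin d) R}
    (hM : HasCyclicPattern σ M) (hN : HasCyclicPattern σ N) : HasCyclicPattern σ (M * N) := by
  intro a c hac
  rw [Matrix.mul_apply] at hac
  obtain ⟨b, -, hb⟩ := Finset.exists_ne_zero_of_sum_ne_zero hac
  exact (hM a b (left_ne_zero_of_mul hb)).trans (hN b c (right_ne_zero_of_mul hb))

open Classical in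
/-- The matrix `M` with the entries that do not belong to the pattern of `σ` replaced by `0`. -/
noncomputable def cyclicTruncate (σ : Finset (Fin d)) (M : Matrix (Fin d) (Fin d) R) :
    Matrix (Fin d) (Fin d) R :=
  Matrix.of fun a b => if CyclicAvoids σ a b then M a b else 0

theorem HasCyclicPattern.cyclicTruncate_eq {σ : Finset (Fin d)} {M : Matrix (Fin d) (Fin d) R}
    (hM : HasCyclicPattern σ M) : cyclicTruncate σ M = M := by
  ext a b
  simp only [cyclicTruncate, Matrix.of_apply]
  split_ifs with h
  · rfl
  · by_contra hne
    exact h (hM a b (Ne.symm hne))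

/-- Truncation to the pattern of `σ` is multiplicative on the matrices that are triangular with
respect to one of the linear orders that cut the cycle. -/
theorem cyclicTruncate_mul {σ τ : Finset (Fin d)} {i : Fin d} (hi : i ∈ τ)
    {M N : Matrix (Fin d) (Fin d) R} (hM : HasCyclicPattern τ M) (hN : HasCyclicPattern τ N) :
    cyclicTruncate σ (M * N) = cyclicTruncate σ M * cyclicTruncate σ N := by
  classical
  ext a c
  have h1 : ∀ b, cyclicTruncate σ M a b * cyclicTruncate σ N b c =
      if CyclicAvoids σ a c then M a b * N b c else 0 := by
    intro b
    simp only [cyclicTruncate, Matrix.of_apply]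
    by_cases hz : M a b = 0
    · simp [hz]
    by_cases hz' : N b c = 0
    · simp [hz']
    by_cases hac : CyclicAvoids σ a c
    · obtain ⟨hab, hbc⟩ := hac.split (hM a b hz i hi) (hN b c hz' i hi)
      rw [if_pos hab, if_pos hbc, if_pos hac]
    · rw [if_neg hac]
      by_cases hab : CyclicAvoids σ a b
      · rw [if_neg (fun hbc => hac (hab.trans hbc)), mul_zero]
      · rw [if_neg hab, zero_mul]
  rw [Matrix.mul_apply, Finset.sum_congr rfl fun b _ => h1 b]
  simp only [cyclicTruncate, Matrix.of_apply, Matrix.mul_apply]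
  split_ifs <;> simp

variable [NeZero d]

theorem hasCyclicPattern_transvection {τ : Finset (Fin d)} {j : Fin d} (hj : j ∉ τ) (r : R) :
    HasCyclicPattern τ (Matrix.transvection j (j + 1) r) := by
  intro a b hab
  by_cases h : a = b
  · exact h ▸ CyclicAvoids.refl τ a
  · rw [Matrix.transvection, Matrix.add_apply, Matrix.one_apply_ne h, zero_add] at hab
    have h2 : j = a ∧ j + 1 = b := by
      by_contra hne
      exact hab (Matrix.single_apply_of_ne _ _ _ _ _ hne)
    obtain ⟨rfl, rfl⟩ := h2
    intro k hk
    have hne : k - j ≠ 0 := fun h0 => hj (sub_eq_zero.mp h0 ▸ hk)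
    rw [← sub_sub, Fin.val_sub_one_of_ne_zero hne]
    exact Nat.sub_le _ _

theorem cyclicTruncate_transvection {σ : Finset (Fin d)} {j : Fin d} (hj : j ∈ σ)
    (hj1 : j ≠ j + 1) (r : R) : cyclicTruncate σ (Matrix.transvection j (j + 1) r) = 1 := by
  ext a b
  simp only [cyclicTruncate, Matrix.of_apply, Matrix.transvection, Matrix.add_apply]
  by_cases h2 : j = a ∧ j + 1 = b
  · obtain ⟨rfl, rfl⟩ := h2
    rw [if_neg, Matrix.one_apply_ne hj1]
    intro h
    have h3 := h j hj
    rw [sub_self, Fin.val_zero, Nat.le_zero, ← Fin.val_zero d, Fin.val_inj, sub_eq_zero] at h3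
    exact hj1 h3
  · rw [Matrix.single_apply_of_ne _ _ _ _ _ h2, add_zero]
    by_cases h : a = b
    · subst h
      rw [if_pos (CyclicAvoids.refl σ a)]
    · simp [Matrix.one_apply_ne h]

end CyclicPattern

/-! ### The subgroups generated by elementary matrices -/

section KaufmanOppenheim

variable (F : Type*) [Field F] (d s : ℕ) [NeZero d]

/-- The group generated by the elementary matrices `e_{j, j+1}(a t + b)` with `j ∉ τ`. -/
noncomputable def koFaceGroup (τ : Finset (Fin d)) :
    Subgroup (Matrix.SpecialLinearGroup (Fin d) (TruncPoly F s)) :=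
  Subgroup.closure {g | ∃ j : Fin d, j ∉ τ ∧ ∃ a b : F,
    (g : Matrix (Fin d) (Fin d) (TruncPoly F s)) =
      Matrix.transvection j (j + 1) (TruncPoly.linear s a b)}

/-- The subgroup `K i`, as a subgroup of `G`. -/
noncomputable abbrev koVertexGroup (i : Fin d) : Subgroup (koGroup F d s) :=
  (koSubgroup F d s i).subgroupOf (koGroup F d s)

variable {F d s}

theorem koSubgroup_eq_koFaceGroup (i : Fin d) : koSubgroup F d s i = koFaceGroup F d s {i} := by
  simp only [koSubgroup, koFaceGroup, Finset.mem_singleton]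

theorem koFaceGroup_anti {σ τ : Finset (Fin d)} (h : σ ⊆ τ) :
    koFaceGroup F d s τ ≤ koFaceGroup F d s σ :=
  Subgroup.closure_mono fun _ ⟨j, hj, hab⟩ => ⟨j, fun hj' => hj (h hj'), hab⟩

theorem fin_ne_add_one (hd : 3 ≤ d) (j : Fin d) : j ≠ j + 1 := by
  intro h
  have h1 : (1 : Fin d) = 0 := left_eq_add.mp h
  have h2 := congrArg Fin.val h1
  rw [Fin.val_one', Fin.val_zero, Nat.mod_eq_of_lt (by omega)] at h2
  omega

theorem fin_ne_add_two (hd : 3 ≤ d) (j : Fin d) : j ≠ j + 1 + 1 := by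
  intro h
  rw [add_assoc] at h
  have h1 : (1 + 1 : Fin d) = 0 := left_eq_add.mp h
  have h2 := congrArg Fin.val h1
  rw [Fin.val_add, Fin.val_one', Fin.val_zero, Nat.mod_eq_of_lt (by omega : 1 < d),
    Nat.mod_eq_of_lt (by omega)] at h2
  omega

theorem koGroup_eq_koFaceGroup (hd : 3 ≤ d) : koGroup F d s = koFaceGroup F d s ∅ := by
  apply le_antisymm
  · refine iSup_le fun i => ?_
    rw [koSubgroup_eq_koFaceGroup]
    exact koFaceGroup_anti (Finset.empty_subset _)
  · refine (Subgroup.closure_le _).mpr ?_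
    rintro g ⟨j, -, hab⟩
    refine (le_iSup (koSubgroup F d s) (j + 1)) (Subgroup.subset_closure ⟨j, ?_, hab⟩)
    exact fin_ne_add_one hd j

theorem koFaceGroup_univ : koFaceGroup F d s Finset.univ = ⊥ := by
  rw [koFaceGroup, Subgroup.closure_eq_bot_iff]
  rintro g ⟨j, hj, -⟩
  exact (hj (Finset.mem_univ j)).elim

theorem TruncPoly.linear_neg (a b : F) :
    TruncPoly.linear s (-a) (-b) = -TruncPoly.linear s a b := by
  simp only [TruncPoly.linear, ← map_neg]
  congr 1
  simp only [map_neg]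
  ring

/-- Truncation to the pattern of `σ` maps the group of type `τ ≠ ∅` to the group of type `τ ∪ σ`:
it fixes some of the generators and maps the others to `1`. -/
theorem koFaceGroup_pattern (hd : 3 ≤ d) (τ : Finset (Fin d))
    {g : Matrix.SpecialLinearGroup (Fin d) (TruncPoly F s)} (hg : g ∈ koFaceGroup F d s τ) :
    HasCyclicPattern τ (g : Matrix (Fin d) (Fin d) (TruncPoly F s)) ∧
    ∀ σ : Finset (Fin d), τ.Nonempty → ∃ g' ∈ koFaceGroup F d s (τ ∪ σ),
      (g' : Matrix (Fin d) (Fin d) (TruncPoly F s)) =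
        cyclicTruncate σ (g : Matrix (Fin d) (Fin d) (TruncPoly F s)) := by
  have hgen : ∀ g : Matrix.SpecialLinearGroup (Fin d) (TruncPoly F s),
      (∃ j : Fin d, j ∉ τ ∧ ∃ a b : F, (g : Matrix (Fin d) (Fin d) (TruncPoly F s)) =
        Matrix.transvection j (j + 1) (TruncPoly.linear s a b)) →
      HasCyclicPattern τ (g : Matrix (Fin d) (Fin d) (TruncPoly F s)) ∧
      ∀ σ : Finset (Fin d), τ.Nonempty → ∃ g' ∈ koFaceGroup F d s (τ ∪ σ),
        (g' : Matrix (Fin d) (Fin d) (TruncPoly F s)) =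
          cyclicTruncate σ (g : Matrix (Fin d) (Fin d) (TruncPoly F s)) := by
    rintro g ⟨j, hj, a, b, hab⟩
    refine ⟨hab ▸ hasCyclicPattern_transvection hj _, fun σ _ => ?_⟩
    by_cases hjσ : j ∈ σ
    · refine ⟨1, one_mem _, ?_⟩
      rw [hab, cyclicTruncate_transvection hjσ (fin_ne_add_one hd j)]
      rfl
    · refine ⟨g, Subgroup.subset_closure ⟨j, ?_, a, b, hab⟩, ?_⟩
      · rw [Finset.mem_union]
        exact fun h => h.elim hj hjσ
      · rw [hab, (hasCyclicPattern_transvection hjσ _).cyclicTruncate_eq]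
  induction hg using Subgroup.closure_induction'' with
  | mem g hg => exact hgen g hg
  | inv_mem g hg =>
    obtain ⟨j, hj, a, b, hab⟩ := hg
    refine hgen _ ⟨j, hj, -a, -b, ?_⟩
    have hmul : g * Matrix.SpecialLinearGroup.transvection (fin_ne_add_one hd j)
        (TruncPoly.linear s (-a) (-b)) = 1 := by
      apply Subtype.ext
      change (g : Matrix (Fin d) (Fin d) (TruncPoly F s)) *
        Matrix.transvection j (j + 1) (TruncPoly.linear s (-a) (-b)) = 1
      rw [hab, Matrix.transvection_mul_transvection_same _ _ (fin_ne_add_one hd j),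
        TruncPoly.linear_neg, add_neg_cancel, Matrix.transvection_zero]
    rw [inv_eq_of_mul_eq_one_right hmul]
    rfl
  | one =>
    refine ⟨HasCyclicPattern.one τ, fun σ _ => ⟨1, one_mem _, ?_⟩⟩
    exact ((HasCyclicPattern.one σ).cyclicTruncate_eq).symm
  | mul g h _ _ ihg ihh =>
    refine ⟨ihg.1.mul ihh.1, fun σ hτ => ?_⟩
    obtain ⟨g', hg', eg⟩ := ihg.2 σ hτ
    obtain ⟨h', hh', eh⟩ := ihh.2 σ hτ
    obtain ⟨i, hi⟩ := hτ
    refine ⟨g' * h', mul_mem hg' hh', ?_⟩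
    rw [Matrix.SpecialLinearGroup.coe_mul, Matrix.SpecialLinearGroup.coe_mul, eg, eh,
      cyclicTruncate_mul hi ihg.1 ihh.1]

/-- The groups `koFaceGroup` intersect as their sets of generators do: an element of the
intersection has the pattern of `σ`, so it is fixed by the truncation, which maps it to the group of
type `τ ∪ σ`. -/
theorem koFaceGroup_inf_le (hd : 3 ≤ d) {σ τ : Finset (Fin d)} (hτ : τ.Nonempty) :
    koFaceGroup F d s τ ⊓ koFaceGroup F d s σ ≤ koFaceGroup F d s (τ ∪ σ) := by
  rintro g ⟨h1, h2⟩
  obtain ⟨g', hg', e⟩ := (koFaceGroup_pattern hd τ h1).2 σ hτ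
  rw [(koFaceGroup_pattern hd σ h2).1.cyclicTruncate_eq] at e
  rwa [← Subtype.ext e]

theorem mem_typeStabilizer_ko (hd : 3 ≤ d) (τ : Finset (Fin d)) (g : koGroup F d s) :
    g ∈ typeStabilizer (koVertexGroup F d s) τ ↔
      (g : Matrix.SpecialLinearGroup (Fin d) (TruncPoly F s)) ∈ koFaceGroup F d s τ := by
  rw [mem_typeStabilizer]
  simp only [Subgroup.mem_subgroupOf, koSubgroup_eq_koFaceGroup]
  constructor
  · induction τ using Finset.induction_on with
    | empty =>
      intro _
      rw [← koGroup_eq_koFaceGroup hd]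
      exact g.2
    | insert i τ _ ih =>
      intro h
      rw [Finset.insert_eq]
      exact koFaceGroup_inf_le hd (Finset.singleton_nonempty i)
        ⟨h i (Finset.mem_insert_self i τ), ih fun j hj => h j (Finset.mem_insert_of_mem hj)⟩
  · exact fun h i hi => koFaceGroup_anti (Finset.singleton_subset_iff.mpr hi) h

theorem iInf_ko (hd : 3 ≤ d) :
    ⨅ i, koVertexGroup F d s i = ⊥ := by
  rw [eq_bot_iff]
  intro g hg
  have h1 : g ∈ typeStabilizer (koVertexGroup F d s)
      Finset.univ := mem_typeStabilizer.mpr fun i _ => Subgroup.mem_iInf.mp hg i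
  rw [mem_typeStabilizer_ko hd, koFaceGroup_univ, Subgroup.mem_bot] at h1
  exact Subgroup.mem_bot.mpr (Subtype.ext h1)

theorem typeStabilizer_ko_le_iSup (hd : 3 ≤ d) (τ : Finset (Fin d)) (hτ : τ.card + 3 ≤ d) :
    typeStabilizer (koVertexGroup F d s) τ ≤
      ⨆ i : {i // i ∉ τ}, typeStabilizer (koVertexGroup F d s) (insert i.1 τ) := by
  set K := koVertexGroup F d s
  have h1 : koFaceGroup F d s τ ≤
      (⨆ i : {i // i ∉ τ}, typeStabilizer K (insert i.1 τ)).map (koGroup F d s).subtype := by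
    refine (Subgroup.closure_le _).mpr ?_
    rintro g ⟨j, hj, hab⟩
    obtain ⟨i, hi⟩ : ∃ i, i ∉ insert j τ := by
      by_contra hall
      push Not at hall
      have h2 := Finset.card_insert_le j τ
      rw [Finset.eq_univ_iff_forall.mpr hall, Finset.card_univ, Fintype.card_fin] at h2
      omega
    rw [Finset.mem_insert, not_or] at hi
    have hg : g ∈ koFaceGroup F d s (insert i τ) := Subgroup.subset_closure ⟨j, by
      rw [Finset.mem_insert, not_or]
      exact ⟨fun h => hi.1 h.symm, hj⟩, hab⟩
    have hgG : g ∈ koGroup F d s := by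
      rw [koGroup_eq_koFaceGroup hd]
      exact koFaceGroup_anti (Finset.empty_subset _) hg
    refine ⟨⟨g, hgG⟩, ?_, rfl⟩
    exact le_iSup (fun i : {i // i ∉ τ} => typeStabilizer K (insert i.1 τ)) ⟨i, hi.2⟩
      ((mem_typeStabilizer_ko hd _ _).mpr hg)
  intro g hg
  obtain ⟨g', hg', e⟩ := h1 ((mem_typeStabilizer_ko hd τ g).mp hg)
  rwa [← Subtype.ext e]

end KaufmanOppenheim

/-! ### Links of codimension two -/

section CodimTwo

open Matrix

/-- A group of Heisenberg type may be recognized inside of a larger group: it suffices that `z`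
commutes with the generators. -/
theorem IsHeisenberg.exists_lift {F S H : Type*} [Field F] [Group S] [Group H] (f : H →* S)
    (hf : Function.Injective f) {x y : F × F → S} {z : F × F → F × F → S}
    (hr : f.range = Subgroup.closure (Set.range x ∪ Set.range y))
    (x_add : ∀ a b, x (a + b) = x a * x b) (y_add : ∀ a b, y (a + b) = y a * y b)
    (z_add_left : ∀ a a' b, z (a + a') b = z a b * z a' b)
    (z_add_right : ∀ a b b', z a (b + b') = z a b * z a b')
    (z_smul : ∀ (c : F) a b, z a (c • b) = z (c • a) b)
    (z_comm_x : ∀ a b c, x c * z a b = z a b * x c)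
    (z_comm_y : ∀ a b c, y c * z a b = z a b * y c)
    (comm : ∀ a b, y b * x a = x a * y b * z a b) :
    ∃ x' y' z', IsHeisenberg (F := F) (H := H) x' y' z' ∧
      (∀ a, f (x' a) = x a) ∧ ∀ a, f (y' a) = y a := by
  have hx : ∀ a, ∃ h, f h = x a := fun a => MonoidHom.mem_range.mp <| by
    rw [hr]; exact Subgroup.subset_closure (Or.inl ⟨a, rfl⟩)
  have hy : ∀ a, ∃ h, f h = y a := fun a => MonoidHom.mem_range.mp <| by
    rw [hr]; exact Subgroup.subset_closure (Or.inr ⟨a, rfl⟩)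
  choose x' hx' using hx
  choose y' hy' using hy
  have hz : ∀ a b, ∃ h, f h = z a b := fun a b =>
    ⟨(x' a * y' b)⁻¹ * (y' b * x' a), by
      simp only [map_mul, map_inv, hx', hy', comm]
      rw [inv_mul_cancel_left]⟩
  choose z' hz' using hz
  have hcentral : ∀ a b, ∀ g ∈ Subgroup.closure (Set.range x ∪ Set.range y),
      g * z a b = z a b * g := by
    intro a b g hg
    have h1 : Subgroup.closure (Set.range x ∪ Set.range y) ≤ Subgroup.centralizer {z a b} := by
      refine (Subgroup.closure_le _).mpr ?_
      rintro _ (⟨c, rfl⟩ | ⟨c, rfl⟩)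
      · exact Subgroup.mem_centralizer_singleton_iff.mpr (z_comm_x a b c)
      · exact Subgroup.mem_centralizer_singleton_iff.mpr (z_comm_y a b c)
    exact Subgroup.mem_centralizer_singleton_iff.mp (h1 hg)
  refine ⟨x', y', z', ⟨?_, ?_, ?_, ?_, ?_, ?_, ?_, ?_⟩, hx', hy'⟩
  · exact fun a b => hf (by simp only [map_mul, hx', x_add])
  · exact fun a b => hf (by simp only [map_mul, hy', y_add])
  · exact fun a a' b => hf (by rw [map_mul, hz', hz', hz', z_add_left])
  · exact fun a b b' => hf (by rw [map_mul, hz', hz', hz', z_add_right])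
  · exact fun c a b => hf (by rw [hz', hz', z_smul])
  · exact fun a b g => hf (by
      rw [map_mul, map_mul, hz']
      exact hcentral a b _ (hr ▸ ⟨g, rfl⟩))
  · exact fun a b => hf (by simp only [map_mul, hx', hy', hz', comm])
  · have h1 : (Subgroup.closure (Set.range x' ∪ Set.range y')).map f = f.range := by
      rw [MonoidHom.map_closure, hr, Set.image_union, ← Set.range_comp, ← Set.range_comp]
      congr 3
      · exact funext hx'
      · exact funext hy'
    rw [MonoidHom.range_eq_map] at h1
    exact Subgroup.map_injective hf h1

variable {n R : Type*} [DecidableEq n] [Fintype n] [CommRing R]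

theorem transvection_mul_of_ne {i j k l : n} (h : j ≠ k) (a b : R) :
    transvection i j a * transvection k l b = 1 + single i j a + single k l b := by
  simp only [transvection, mul_add, add_mul, one_mul, mul_one, single_mul_single_of_ne _ _ _ _ h]
  abel

theorem transvection_commute {i j k l : n} (h : j ≠ k) (h' : l ≠ i) (a b : R) :
    transvection i j a * transvection k l b = transvection k l b * transvection i j a := by
  rw [transvection_mul_of_ne h, transvection_mul_of_ne h']
  abel

theorem transvection_commutator {i j k : n} (hij : j ≠ i) (hik : k ≠ i) (a b : R) :
    transvection i j b * transvection j k a =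
      transvection j k a * transvection i j b * transvection i k (a * b) := by
  rw [transvection_mul_of_ne hik]
  simp only [transvection, mul_add, add_mul, one_mul, mul_one, single_mul_single_same,
    single_mul_single_of_ne _ _ _ _ hik, single_mul_single_of_ne _ _ _ _ hij, mul_comm b a]
  abel

end CodimTwo

section KaufmanOppenheim

variable {F : Type*} [Field F] {d s : ℕ} [NeZero d]

theorem TruncPoly.linear_add (a b : F × F) : TruncPoly.linear s (a + b).1 (a + b).2 =
    TruncPoly.linear s a.1 a.2 + TruncPoly.linear s b.1 b.2 := by
  simp only [TruncPoly.linear, ← map_add, Prod.fst_add, Prod.snd_add]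
  congr 1
  simp only [map_add]
  ring

theorem TruncPoly.linear_smul_mul (c : F) (a b : F × F) :
    TruncPoly.linear s a.1 a.2 * TruncPoly.linear s (c • b).1 (c • b).2 =
      TruncPoly.linear s (c • a).1 (c • a).2 * TruncPoly.linear s b.1 b.2 := by
  simp only [TruncPoly.linear, ← map_mul, Prod.smul_fst, Prod.smul_snd, smul_eq_mul]
  congr 1
  simp only [map_mul]
  ring

/-- The elementary matrix `e_{j, j+1}(a t + b)` as an element of the special linear group. -/
noncomputable def koElem (hd : 3 ≤ d) (j : Fin d) (a : F × F) :
    Matrix.SpecialLinearGroup (Fin d) (TruncPoly F s) :=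
  Matrix.SpecialLinearGroup.transvection (fin_ne_add_one hd j) (TruncPoly.linear s a.1 a.2)

theorem koFaceGroup_eq_closure (hd : 3 ≤ d) {τ : Finset (Fin d)} {i j : Fin d}
    (hc : τᶜ = {i, j}) : koFaceGroup F d s τ =
      Subgroup.closure (Set.range (koElem hd j) ∪ Set.range (koElem hd i)) := by
  unfold koFaceGroup
  congr 1
  have hmem : ∀ l, l ∉ τ ↔ l = i ∨ l = j := fun l => by
    rw [← Finset.mem_compl, hc, Finset.mem_insert, Finset.mem_singleton]
  ext g
  constructor
  · rintro ⟨l, hl, a, b, hab⟩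
    rcases (hmem l).mp hl with rfl | rfl
    · exact Or.inr ⟨(a, b), Subtype.ext hab.symm⟩
    · exact Or.inl ⟨(a, b), Subtype.ext hab.symm⟩
  · rintro (⟨a, rfl⟩ | ⟨a, rfl⟩)
    · exact ⟨j, (hmem j).mpr (Or.inr rfl), a.1, a.2, rfl⟩
    · exact ⟨i, (hmem i).mpr (Or.inl rfl), a.1, a.2, rfl⟩

/-- The stabilizer of a face of codimension two is of Heisenberg type. If the two missing types `i`
and `j` are cyclically adjacent, then it is a group of unipotent `3 × 3` matrices; otherwise it is
abelian. -/
theorem exists_isHeisenberg_ko (hd : 3 ≤ d) {τ : Finset (Fin d)} {i j : Fin d}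
    (hc : τᶜ = {i, j}) (hadj : j + 1 ≠ i) {H : Type*} [Group H]
    (f : H →* Matrix.SpecialLinearGroup (Fin d) (TruncPoly F s)) (hf : Function.Injective f)
    (hr : f.range = koFaceGroup F d s τ) :
    ∃ x y z, IsHeisenberg (F := F) (H := H) x y z ∧
      (∀ a, f (x a) = koElem hd j a) ∧ ∀ a, f (y a) = koElem hd i a := by
  have hadd : ∀ (l : Fin d) (a b : F × F),
      koElem (s := s) hd l (a + b) = koElem hd l a * koElem hd l b := by
    intro l a b
    apply Subtype.ext
    change Matrix.transvection l (l + 1) _ =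
      Matrix.transvection l (l + 1) _ * Matrix.transvection l (l + 1) _
    rw [Matrix.transvection_mul_transvection_same _ _ (fin_ne_add_one hd l), TruncPoly.linear_add]
  rw [koFaceGroup_eq_closure hd hc] at hr
  -- adjacent types give a commutator `e_{i, i+2}`, others commute
  by_cases hj : i + 1 = j
  · subst hj
    have h1 : i + 1 ≠ i := (fin_ne_add_one hd i).symm
    have h2 : i + 1 + 1 ≠ i := (fin_ne_add_two hd i).symm
    have h3 : i + 1 + 1 ≠ i + 1 := (fin_ne_add_one hd (i + 1)).symm
    refine IsHeisenberg.exists_lift f hf (z := fun a b =>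
      Matrix.SpecialLinearGroup.transvection h2.symm
        (TruncPoly.linear s a.1 a.2 * TruncPoly.linear s b.1 b.2)) hr (hadd _) (hadd _)
      (fun a a' b => ?_) (fun a b b' => ?_) (fun c a b => ?_) (fun a b c => ?_)
      (fun a b c => ?_) (fun a b => ?_) <;> apply Subtype.ext
    · change Matrix.transvection i (i + 1 + 1) _ =
        Matrix.transvection i (i + 1 + 1) _ * Matrix.transvection i (i + 1 + 1) _
      rw [Matrix.transvection_mul_transvection_same _ _ h2.symm, TruncPoly.linear_add, add_mul]
    · change Matrix.transvection i (i + 1 + 1) _ =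
        Matrix.transvection i (i + 1 + 1) _ * Matrix.transvection i (i + 1 + 1) _
      rw [Matrix.transvection_mul_transvection_same _ _ h2.symm, TruncPoly.linear_add, mul_add]
    · change Matrix.transvection i (i + 1 + 1) _ = Matrix.transvection i (i + 1 + 1) _
      rw [TruncPoly.linear_smul_mul]
    · exact transvection_commute h2 h3 _ _
    · exact transvection_commute h1 h2 _ _
    · exact transvection_commutator h1 h2 _ _
  · refine IsHeisenberg.exists_lift f hf (z := fun _ _ => 1) hr (hadd _) (hadd _)
      (fun _ _ _ => (mul_one 1).symm) (fun _ _ _ => (mul_one 1).symm) (fun _ _ _ => rfl)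
      (fun _ _ c => by rw [mul_one, one_mul]) (fun _ _ c => by rw [mul_one, one_mul])
      (fun a b => ?_)
    rw [mul_one]
    exact Subtype.ext (transvection_commute hj hadj _ _)

theorem koElem_mem_koSubgroup (hd : 3 ≤ d) {i j : Fin d} (hij : j ≠ i) (a : F × F) :
    koElem hd j a ∈ koSubgroup F d s i :=
  Subgroup.subset_closure ⟨j, hij, a.1, a.2, rfl⟩

theorem exists_compl_eq_pair (hd : 3 ≤ d) (τ : Finset (Fin d)) (hτ : τ.card + 2 = d) :
    ∃ i j, i ≠ j ∧ τᶜ = {i, j} ∧ j + 1 ≠ i := by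
  have h1 : τᶜ.card = 2 := by rw [Finset.card_compl, Fintype.card_fin]; omega
  obtain ⟨i, j, hij, hc⟩ := Finset.card_eq_two.mp h1
  by_cases h : j + 1 = i
  · exact ⟨j, i, hij.symm, by rw [hc, Finset.pair_comm], fun h' =>
      fin_ne_add_two hd j (by rw [h, h'])⟩
  · exact ⟨i, j, hij, hc, h⟩

theorem codim_two_gap_ko [Fintype F] (hd : 3 ≤ d) (τ : Finset (Fin d)) (hτ : τ.card + 2 = d) :
    ∃ i j, i ≠ j ∧ τᶜ = {i, j} ∧
      ∀ [Fintype (typeStabilizer (koVertexGroup F d s) τ)]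
        (φ ψ : typeStabilizer (koVertexGroup F d s) τ → ℝ),
        (∀ h k : typeStabilizer (koVertexGroup F d s) τ,
          (k : koGroup F d s) ∈ koVertexGroup F d s i → φ (h * k) = φ h) →
        (∀ h k : typeStabilizer (koVertexGroup F d s) τ,
          (k : koGroup F d s) ∈ koVertexGroup F d s j → ψ (h * k) = ψ h) →
        ∑ h, φ h = 0 →
        (Fintype.card F : ℝ) * (∑ h, φ h * ψ h) ^ 2 ≤ (∑ h, φ h ^ 2) * ∑ h, ψ h ^ 2 := by
  obtain ⟨i, j, hij, hc, hadj⟩ := exists_compl_eq_pair hd τ hτ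
  refine ⟨i, j, hij, hc, fun φ ψ hφ hψ h0 => ?_⟩
  obtain ⟨x, y, z, hxyz, hx, hy⟩ := exists_isHeisenberg_ko hd hc hadj
    ((koGroup F d s).subtype.comp (typeStabilizer (koVertexGroup F d s) τ).subtype)
    (Subtype.val_injective.comp Subtype.val_injective) (by
      ext g
      constructor
      · rintro ⟨h, rfl⟩
        exact (mem_typeStabilizer_ko hd τ _).mp h.2
      · intro hg
        have hgG : g ∈ koGroup F d s := by
          rw [koGroup_eq_koFaceGroup hd]
          exact koFaceGroup_anti (Finset.empty_subset _) hg
        exact ⟨⟨⟨g, hgG⟩, (mem_typeStabilizer_ko hd τ _).mpr hg⟩, rfl⟩)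
  refine hxyz.card_mul_sq_sum_mul_le (fun h a => hφ h _ ?_) (fun h a => hψ h _ ?_) h0
  · rw [Subgroup.mem_subgroupOf]
    have h1 := koElem_mem_koSubgroup (s := s) hd hij.symm a
    rwa [← hx a] at h1
  · rw [Subgroup.mem_subgroupOf]
    have h1 := koElem_mem_koSubgroup (s := s) hd hij a
    rwa [← hy a] at h1

end KaufmanOppenheim

theorem mainTheorem1 (F : Type*) [Field F] [Fintype F] (p : ℕ) (hp : Fintype.card F = p)
    (d s : ℕ) [NeZero d] (hd : 3 ≤ d) (hs : 1 ≤ s) (hpd : ((d : ℝ) - 2) ^ 2 < (p : ℝ)) :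
    (koComplex F d s).IsOnesidedSpectralHDX ((koComplex F d s).uniformWeight (d - 1)) (d - 1)
      (1 / (Real.sqrt p - ((d : ℝ) - 2))) := by
  have hcast : ((d - 1 : ℕ) : ℝ) - 1 = (d : ℝ) - 2 := by
    rw [Nat.cast_sub (by omega)]; push_cast; ring
  rw [← hcast]
  have hd3 : (3 : ℝ) ≤ d := by exact_mod_cast hd
  refine cosetComplex_isOnesidedSpectralHDX (K := koVertexGroup F d s) (by omega)
    (by rw [Fintype.card_fin]; omega)
    (iInf_ko hd) (fun τ hτ => typeStabilizer_ko_le_iSup hd τ (by simpa using hτ)) ?_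
    (fun τ hτ => ?_)
  · rw [hcast]
    exact (Real.lt_sqrt (by linarith)).mpr hpd
  · rw [← hp]
    exact codim_two_gap_ko hd τ (by simpa using hτ)
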